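/- Let $\mathcal W(5,2)$ be the symplectic polar space of a $6$-dimensional vector space $V$ over $\mathbb F_2$ with a non-degenerate alternating bilinear form $B$: its points are all the points of $\mathrm{PG}(V)=\mathrm{PG}(5,2)$, and its generators are the totally isotropic subspaces of maximum dimension (planes of $\mathrm{PG}(5,2)$). An $m$-ovoid of $\mathcal W(5,2)$ is a set of points meeting every generator in exactly $m$ points; the complement of an $m$-ovoid is a $(7-m)$-ovoid. Two sets of points in symplectic polar spaces over $\mathbb F_2$ are isomorphic if a collineation between the ambient projective spaces maps one orthogonality relation to the other and one point set onto the other. (a) For $1\le m\le 3$, $\mathcal W(5,2)$ has an $m$-ovoid if and only if $m=3$. Hence, complements and the trivial cases ($\emptyset$ for $m=0$, all points for $m=7$) included, $\mathcal W(5,2)$ has an $m$-ovoid if and only if $m\in\{0,3,4,7\}$. (b) Up to isomorphism, $\mathcal W(5,2)$ has exactly three $3$-ovoids. They are pairwise non-isomorphic and are the following. 1. The elliptic quadric $\mathcal Q^-(5,2)$ polarizing to $\mathcal W(5,2)$, that is, the set of zeros in $\mathrm{PG}(V)$ of a quadratic form on $V$ whose polar form is non-degenerate and has the same orthogonality relation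 as $B$, and whose largest totally singular subspaces have vector space dimension $2$. All such quadrics are isomorphic. 2. The quadric $$X_1^2+X_1X_6+\delta X_6^2+X_2X_5+X_3X_4+\mu\,(X_4^2+X_4X_5+\delta X_5^2)=0$$ of $\mathrm{PG}(5,2)$, where $\delta\in\mathbb F_2$ is such that $X^2+X+\delta$ is irreducible over $\mathbb F_2$ and $\mu\in\mathbb F_2\setminus\{0\}$ (so $\delta=\mu=1$), in the polar space $\mathcal W(5,2)$ of the alternating form $X_1Y_6+X_2Y_5+X_3Y_4+X_4Y_3+X_5Y_2+X_6Y_1$. 3. Let $q=2$, let $\omega\in\mathbb F_4\setminus\mathbb F_2$ with $\omega+\omega^q=1$, and let $\gamma\in\mathbb F_4$ be such that $X^2+X+\gamma$ is irreducible over $\mathbb F_4$. Let $\Sigma\cong\mathrm{PG}(5,2)$ be the Baer subgeometry of $\mathrm{PG}(5,4)$ given by the $\mathbb F_2$-space of the vectors $(\alpha,\alpha^q,\delta_0,\beta,\beta^q,\delta_1)$ with $\alpha,\beta\in\mathbb F_4$, $\delta_0,\delta_1\in\mathbb F_2$, and let $\mathcal W(5,2)$ be the polar space on $\Sigma$ of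 the form $\sum_{i,j}X_iJ_{ij}Y_j^q$, which is alternating and non-degenerate there, where $$J=\begin{pmatrix}0&0&0&\omega&0&\omega^q\\0&0&0&0&\omega^q&\omega\\0&0&0&0&0&1\\\omega^q&0&0&0&0&0\\0&\omega&0&0&0&0\\\omega&\omega^q&1&0&0&0\end{pmatrix}.$$ The $3$-ovoid is $\mathcal Q\cup S_\gamma^G$. Here $\mathcal Q$ is the set of points of $\Sigma$ with $X_6=X_3^2+X_1X_5+X_2X_4=0$, $S_\gamma$ is the point $\left(\frac{\gamma}{\omega},\frac{\gamma^q}{\omega^q},\frac{\omega^q\gamma}{\omega}+\frac{\omega\gamma^q}{\omega^q},1,1,1\right)$ of $\Sigma$, and $G$ is the group generated by the matrices (acting on column vectors) $$M_{a,b,c,d}=\begin{pmatrix}a^2&0&0&0&c^2&\frac{c(a+c\omega^q)}{\omega}\\0&a^{2q}&0&c^{2q}&0&\frac{c^q(a^q+c^q\omega)}{\omega^q}\\ab&a^qb^q&1&c^qd^q&cd&\frac{d(a+c\omega^q)}{\omega}+\frac{d^q(a^q+c^q\omega)}{\omega^q}+\frac{1}{\omega^{q+1}}\\0&b^{2q}&0&d^{2q}&0&\frac{d^q(b^q+d^q\omega)+\omega}{\omega^q}\\b^2&0&0&0&d^2&\frac{d(b+d\omega^q)+\omega^q}{\omega}\\0&0&0&0&0&1\end{pmatrix}$$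 with $a,b,c,d\in\mathbb F_4$ and $ad+bc=1$. The isomorphism class does not depend on the choice of $\omega$ and $\gamma$. -/

import Mathlib

open scoped LinearAlgebra.Projectivization

noncomputable section

namespace SymplecticOvoid

/-! ### Symplectic polar spaces and their `m`-ovoids -/

section PolarSpace

variable {K V M : Type*} [Field K] [AddCommGroup V] [Module K V] [AddCommGroup M] [Module K M]

/-- The subspace `g` is totally isotropic with respect to the bilinear form `B`. (The form may
take values in any `K`-vector space; only the relation `B x y = 0` matters.) -/
def IsTotallyIsotropic (B : V →ₗ[K] V →ₗ[K] M) (g : Submodule K V) : Prop :=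
  ∀ x ∈ g, ∀ y ∈ g, B x y = 0

/-- A generator: a totally isotropic subspace of maximum dimension. -/
def IsGenerator (B : V →ₗ[K] V →ₗ[K] M) (g : Submodule K V) : Prop :=
  IsTotallyIsotropic B g ∧
    ∀ g' : Submodule K V, IsTotallyIsotropic B g' → Module.finrank K g' ≤ Module.finrank K g

/-- An `m`-ovoid: a set of points of `PG(V)` that meets every generator in exactly `m` points.
(The form `B` is alternating wherever this is used, so every point of `PG(V)` is a point of the
polar space.) -/
def IsMOvoid (B : V →ₗ[K] V →ₗ[K] M) (m : ℕ) (X : Set (ℙ K V)) : Prop :=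
  ∀ g : Submodule K V, IsGenerator B g → {P ∈ X | P.submodule ≤ g}.encard = m

end PolarSpace

/-- Isomorphism of point sets of two symplectic polar spaces over `𝔽₂`: some collineation of the
ambient projective spaces carries one orthogonality relation to the other and one point set onto
the other. As `𝔽₂` has no nontrivial field automorphism, all collineations are linear. -/
def Isomorphic {V M V' M' : Type*}
    [AddCommGroup V] [Module (ZMod 2) V] [AddCommGroup M] [Module (ZMod 2) M]
    [AddCommGroup V'] [Module (ZMod 2) V'] [AddCommGroup M'] [Module (ZMod 2) M']
    (B : V →ₗ[ZMod 2] V →ₗ[ZMod 2] M) (X : Set (ℙ (ZMod 2) V))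
    (B' : V' →ₗ[ZMod 2] V' →ₗ[ZMod 2] M') (X' : Set (ℙ (ZMod 2) V')) : Prop :=
  ∃ e : V ≃ₗ[ZMod 2] V', (∀ x y, B x y = 0 ↔ B' (e x) (e y) = 0) ∧
    Projectivization.map (e : V →ₗ[ZMod 2] V') e.injective '' X = X'

/-! ### Elliptic quadrics -/

section Quadric

variable {K V : Type*} [Field K] [AddCommGroup V] [Module K V]

/-- The quadratic form `Q` is elliptic: its polar form is non-degenerate, and the totally singular
subspaces of largest dimension have dimension `n`, where `dim V = 2 * n + 2`. -/
def IsElliptic (Q : QuadraticForm K V) : Prop :=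
  LinearMap.Nondegenerate (QuadraticMap.polarBilin Q) ∧
    ∃ n : ℕ, Module.finrank K V = 2 * n + 2 ∧
      IsGreatest {d : ℕ | ∃ U : Submodule K V, (∀ x ∈ U, Q x = 0) ∧ Module.finrank K U = d} n

/-- `X` is the point set of an elliptic quadric whose associated polarity is the one of `B`. -/
def IsEllipticQuadricPolarizingTo (B : V →ₗ[K] V →ₗ[K] K) (X : Set (ℙ K V)) : Prop :=
  ∃ Q : QuadraticForm K V, IsElliptic Q ∧
    (∀ x y, QuadraticMap.polar Q x y = 0 ↔ B x y = 0) ∧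
    X = {P : ℙ K V | Q P.rep = 0}

end Quadric

/-! ### The first construction, in `PG(5, q)` -/

section First

variable {K : Type*} [Field K]

/-- The alternating form (`q` even) `X₁Y₆ + X₂Y₅ + X₃Y₄ + X₄Y₃ + X₅Y₂ + X₆Y₁`. -/
def antidiagForm (K : Type*) [Field K] : (Fin 6 → K) →ₗ[K] (Fin 6 → K) →ₗ[K] K :=
  Matrix.toLinearMap₂' K
    !![0, 0, 0, 0, 0, 1;
       0, 0, 0, 0, 1, 0;
       0, 0, 0, 1, 0, 0;
       0, 0, 1, 0, 0, 0;
       0, 1, 0, 0, 0, 0;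
       1, 0, 0, 0, 0, (0 : K)]

/-- The left-hand side of the equation of the quadric `Q_μ`,
`X₁² + X₁X₆ + δX₆² + X₂X₅ + X₃X₄ + μ(X₄² + X₄X₅ + δX₅²)` (the coordinate `X_i` is `x (i - 1)`). -/
def pencilPoly (δ μ : K) (x : Fin 6 → K) : K :=
  x 0 ^ 2 + x 0 * x 5 + δ * x 5 ^ 2 + x 1 * x 4 + x 2 * x 3
    + μ * (x 3 ^ 2 + x 3 * x 4 + δ * x 4 ^ 2)

/-- The point set of the quadric `Q_μ`. -/
def pencilQuadric (δ μ : K) : Set (ℙ K (Fin 6 → K)) :=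
  {P | pencilPoly δ μ P.rep = 0}

end First

/-! ### The second construction, in a Baer subgeometry of `PG(5, q²)` -/

section Second

variable (K : Type*) {L : Type*} [Field K] [Fintype K] [Field L] [Algebra K L]

/-- The map `x ↦ x ^ q`, where `q = |K|`. -/
abbrev frob : L →ₐ[K] L := FiniteField.frobeniusAlgHom K L

variable (L) in
/-- The `K`-space of the vectors `(α, α^q, δ₀, β, β^q, δ₁)`, with `α, β ∈ L` and `δ₀, δ₁ ∈ K`. -/
def baerSubspace : Submodule K (Fin 6 → L) where
  carrier := {x | ∃ (α β : L) (d₀ d₁ : K),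
    x = ![α, frob K α, algebraMap K L d₀, β, frob K β, algebraMap K L d₁]}
  add_mem' := by
    rintro _ _ ⟨α, β, d₀, d₁, rfl⟩ ⟨α', β', d₀', d₁', rfl⟩
    exact ⟨α + α', β + β', d₀ + d₀', d₁ + d₁', by simp only [map_add]; simp⟩
  zero_mem' := ⟨0, 0, 0, 0, by ext i; fin_cases i <;> simp⟩
  smul_mem' := by
    rintro c _ ⟨α, β, d₀, d₁, rfl⟩
    exact ⟨c • α, c • β, c * d₀, c * d₁, by
      simp only [map_smul, map_mul]
      ext i
      fin_cases i <;> simp [Algebra.smul_def]⟩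

/-- The Gram matrix of the Hermitian form that defines `H(5, q²)`. -/
def hermMatrix (ω : L) : Matrix (Fin 6) (Fin 6) L :=
  !![0, 0, 0, ω, 0, frob K ω;
     0, 0, 0, 0, frob K ω, ω;
     0, 0, 0, 0, 0, 1;
     frob K ω, 0, 0, 0, 0, 0;
     0, ω, 0, 0, 0, 0;
     ω, frob K ω, 1, 0, 0, 0]

/-- The restriction to the Baer subgeometry of the Hermitian form `∑ i j, X_i J_ij Y_j ^ q`: a
`K`-bilinear form, whose polar space is the `W(5, q)` of the second construction. -/
def baerForm (ω : L) : baerSubspace K L →ₗ[K] baerSubspace K L →ₗ[K] L :=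
  LinearMap.mk₂ K
    (fun x y => ∑ i, ∑ j, (x : Fin 6 → L) i * hermMatrix K ω i j * frob K ((y : Fin 6 → L) j))
    (fun x x' y => by simp [add_mul, Finset.sum_add_distrib])
    (fun c x y => by simp [Finset.smul_sum])
    (fun x y y' => by
      simp only [Submodule.coe_add, Pi.add_apply, map_add, mul_add, Finset.sum_add_distrib])
    (fun c x y => by simp [Finset.smul_sum])

/-- The matrix `M_{a,b,c,d}`. -/
def groupMatrix (ω a b c d : L) : Matrix (Fin 6) (Fin 6) L :=
  let f : L → L := frob K
  !![a ^ 2, 0, 0, 0, c ^ 2, c * (a + c * f ω) / ω;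
     0, f (a ^ 2), 0, f (c ^ 2), 0, f c * (f a + f c * ω) / f ω;
     a * b, f a * f b, 1, f c * f d, c * d,
       d * (a + c * f ω) / ω + f d * (f a + f c * ω) / f ω + 1 / (f ω * ω);
     0, f (b ^ 2), 0, f (d ^ 2), 0, (f d * (f b + f d * ω) + ω) / f ω;
     b ^ 2, 0, 0, 0, d ^ 2, (d * (b + d * f ω) + f ω) / ω;
     0, 0, 0, 0, 0, 1]

/-- The group generated by the matrices `M_{a,b,c,d}` with `ad + bc = 1`. -/
def groupG (ω : L) : Subgroup (GL (Fin 6) L) :=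
  Subgroup.closure {g | ∃ a b c d : L, a * d + b * c = 1 ∧
    (g : Matrix (Fin 6) (Fin 6) L) = groupMatrix K ω a b c d}

/-- A vector representing the point `S_γ`. -/
def pointS (ω γ : L) : Fin 6 → L :=
  let f : L → L := frob K
  ![γ / ω, f γ / f ω, f ω * γ / ω + ω * f γ / f ω, 1, 1, 1]

/-- The points of the parabolic quadric `X₆ = X₃² + X₁X₅ + X₂X₄ = 0` in the Baer subgeometry. -/
def parabolicQuadric (K L : Type*) [Field K] [Fintype K] [Field L] [Algebra K L] :
    Set (ℙ K (baerSubspace K L)) :=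
  {P | (P.rep : Fin 6 → L) 5 = 0 ∧
    (P.rep : Fin 6 → L) 2 ^ 2 + (P.rep : Fin 6 → L) 0 * (P.rep : Fin 6 → L) 4
      + (P.rep : Fin 6 → L) 1 * (P.rep : Fin 6 → L) 3 = 0}

/-- The points of the Baer subgeometry that lie in the orbit of `S_γ` under the group: as points
of `PG(5, q²)`, they are represented by nonzero multiples of a vector `g S_γ`. -/
def orbitS (ω γ : L) : Set (ℙ K (baerSubspace K L)) :=
  {P | ∃ g ∈ groupG K ω, ∃ t : L, t ≠ 0 ∧
    (P.rep : Fin 6 → L) = t • ((g : Matrix (Fin 6) (Fin 6) L).mulVec (pointS K ω γ))}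

/-- The union of the parabolic quadric and the orbit of `S_γ`. -/
def gluedSet (ω γ : L) : Set (ℙ K (baerSubspace K L)) :=
  parabolicQuadric K L ∪ orbitS K ω γ

end Second

end SymplecticOvoid

end

/-! Over `𝔽₂` a point of the projective space is the same thing as a nonzero vector, so after
choosing a symplectic basis a point becomes a number below 64 (its binary coordinates), a set of
points becomes the positions of the bits of one natural number `R`, and orthogonality becomes the
Boolean function `codeForm`. Two point sets with the same `R` in two symplectic bases are
isomorphic, even if the bases belong to different spaces, because the linear map matching the bases
preserves codes (`isomorphic_pointSet`). The common nonzero value of the form on dual basis pairs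
may lie in any module; this covers `baerForm`, whose values lie in `𝔽₄`.

The generators are the totally isotropic subspaces of dimension 3, each with 7 points. Classifying
`m`-ovoids is then an exhaustive search with symmetry breaking: some points are known to be present
and some to be absent, each generator with `m` present or `7 - m` absent points decides its
remaining points, and a branch on a point uses symplectic maps that preserve the current knowledge.
The search is recorded as a `CaseTree`. The Boolean `CaseTree.check` is evaluated by the kernel, and
`CaseTree.exists_eq_pointSet` shows that a successful check implies that every `m`-ovoid is one of
the listed sets in some symplectic basis. For `m = 1, 2` the list is empty; for `m = 3` it has three
members. Complements turn these results into the answer for all `m`.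

The three sets are told apart by two isomorphism invariants, `IsLineClosed` and `IsCoveredByLines`.
They are identified with the named examples by computing codes. An arbitrary elliptic quadric is
moved to the standard one by a transvection (`exists_eq_pointSet_ellipticCode`). In the second
construction `𝔽₄` is encoded by the numbers 0 to 3 in terms of `ω`, so that all admissible `ω` and
`γ` give the same code (`gluedSet_eq`). -/

namespace SymplecticOvoid

open Module

/-! ### Points of projective spaces over `𝔽₂` as nonzero vectors -/

section Points

variable {V V' : Type*} [AddCommGroup V] [Module (ZMod 2) V] [AddCommGroup V'] [Module (ZMod 2) V']

/-- The nonzero vectors representing the points of `X`. -/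
def vectors (X : Set (ℙ (ZMod 2) V)) : Set V := Projectivization.rep '' X

lemma rep_mk (v : V) (hv : v ≠ 0) : (Projectivization.mk (ZMod 2) v hv).rep = v := by
  obtain ⟨a, ha⟩ := Projectivization.exists_smul_eq_mk_rep (ZMod 2) v hv
  rw [← ha, Subsingleton.elim a 1, one_smul]

lemma rep_injective : Function.Injective (Projectivization.rep : ℙ (ZMod 2) V → V) := by
  intro P P' h
  rw [← P.mk_rep, ← P'.mk_rep]
  simp only [h]

lemma rep_mem_vectors {X : Set (ℙ (ZMod 2) V)} {P : ℙ (ZMod 2) V} :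
    P.rep ∈ vectors X ↔ P ∈ X :=
  rep_injective.mem_set_image

lemma zero_notMem_vectors (X : Set (ℙ (ZMod 2) V)) : (0 : V) ∉ vectors X := by
  rintro ⟨P, -, h⟩
  exact P.rep_nonzero h

lemma rep_map (e : V ≃ₗ[ZMod 2] V') (P : ℙ (ZMod 2) V) :
    (P.map (e : V →ₗ[ZMod 2] V') e.injective).rep = e P.rep := by
  induction P using Projectivization.ind with
  | h v hv => rw [Projectivization.map_mk, rep_mk, rep_mk]; rfl

lemma ext_of_vectors {X Y : Set (ℙ (ZMod 2) V)} (h : ∀ v, v ∈ vectors X ↔ v ∈ vectors Y) :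
    X = Y := by
  ext P
  rw [← rep_mem_vectors, h, rep_mem_vectors]

lemma mem_vectors_image_map (e : V ≃ₗ[ZMod 2] V') (X : Set (ℙ (ZMod 2) V)) (v : V) :
    e v ∈ vectors (Projectivization.map (e : V →ₗ[ZMod 2] V') e.injective '' X) ↔
      v ∈ vectors X := by
  constructor
  · rintro ⟨_, ⟨P, hP, rfl⟩, h⟩
    rw [rep_map] at h
    exact ⟨P, hP, e.injective h⟩
  · rintro ⟨P, hP, rfl⟩
    exact ⟨_, ⟨P, hP, rfl⟩, rep_map e P⟩

lemma submodule_le_iff (P : ℙ (ZMod 2) V) (g : Submodule (ZMod 2) V) :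
    P.submodule ≤ g ↔ P.rep ∈ g := by
  rw [Projectivization.submodule_eq, Submodule.span_singleton_le_iff_mem]

lemma encard_points_le (X : Set (ℙ (ZMod 2) V)) (g : Submodule (ZMod 2) V) :
    {P ∈ X | P.submodule ≤ g}.encard = {v ∈ vectors X | v ∈ g}.encard := by
  rw [← rep_injective.encard_image]
  congr 1
  ext v
  constructor
  · rintro ⟨P, ⟨hP, hg⟩, rfl⟩
    exact ⟨⟨P, hP, rfl⟩, (submodule_le_iff P g).1 hg⟩
  · rintro ⟨⟨P, hP, rfl⟩, hg⟩
    exact ⟨P, ⟨hP, (submodule_le_iff P g).2 hg⟩, rfl⟩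

lemma isomorphic_iff {M M' : Type*} [AddCommGroup M] [Module (ZMod 2) M]
    [AddCommGroup M'] [Module (ZMod 2) M']
    {B : V →ₗ[ZMod 2] V →ₗ[ZMod 2] M} {B' : V' →ₗ[ZMod 2] V' →ₗ[ZMod 2] M'}
    {X : Set (ℙ (ZMod 2) V)} {X' : Set (ℙ (ZMod 2) V')} :
    Isomorphic B X B' X' ↔ ∃ e : V ≃ₗ[ZMod 2] V', (∀ x y, B x y = 0 ↔ B' (e x) (e y) = 0) ∧
      ∀ v, v ∈ vectors X ↔ e v ∈ vectors X' := by
  refine exists_congr fun e => and_congr_right fun _ => ⟨?_, fun h => ?_⟩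
  · rintro rfl v
    exact (mem_vectors_image_map e X v).symm
  · refine ext_of_vectors fun w => ?_
    obtain ⟨v, rfl⟩ := e.surjective w
    rw [mem_vectors_image_map, h]

end Points

/-! ### Binary codes of vectors -/

section Codes

variable {V M : Type*} [AddCommGroup V] [Module (ZMod 2) V] [AddCommGroup M] [Module (ZMod 2) M]

/-- A bit as an element of `𝔽₂`. -/
def boolToF2 (b : Bool) : ZMod 2 := b.toNat

lemma boolToF2_xor (b c : Bool) : boolToF2 (b ^^ c) = boolToF2 b + boolToF2 c := by
  revert b c; decide

lemma boolToF2_and (b c : Bool) : boolToF2 (b && c) = boolToF2 b * boolToF2 c := by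
  revert b c; decide

lemma boolToF2_eq_zero (b : Bool) : boolToF2 b = 0 ↔ b = false := by
  revert b; decide

/-- The vector whose coordinates with respect to `u` are the binary digits of `n`. -/
def vec (u : Fin 6 → V) (n : ℕ) : V := ∑ i : Fin 6, boolToF2 (n.testBit i) • u i

lemma vec_xor (u : Fin 6 → V) (a b : ℕ) : vec u (a ^^^ b) = vec u a + vec u b := by
  simp [vec, Nat.testBit_xor, boolToF2_xor, add_smul, Finset.sum_add_distrib]

lemma vec_zero (u : Fin 6 → V) : vec u 0 = 0 := by
  simp [vec, boolToF2]

lemma exists_code (f : Fin 6 → ZMod 2) : ∃ n < 64, ∀ i : Fin 6, boolToF2 (n.testBit i) = f i := by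
  have h : ∀ a b c d e f : ZMod 2, ∃ n < 64,
      ∀ i : Fin 6, boolToF2 (n.testBit i) = ![a, b, c, d, e, f] i := by decide +kernel
  obtain ⟨n, hn, hf⟩ := h (f 0) (f 1) (f 2) (f 3) (f 4) (f 5)
  refine ⟨n, hn, fun i => ?_⟩
  rw [hf]
  fin_cases i <;> rfl

lemma eq_of_testBit_eq {a b : ℕ} (ha : a < 64) (hb : b < 64)
    (h : ∀ i : Fin 6, a.testBit i = b.testBit i) : a = b := by
  refine Nat.eq_of_testBit_eq fun i => ?_
  by_cases hi : i < 6
  · exact h ⟨i, hi⟩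
  · have h64 : 64 ≤ 2 ^ i := Nat.pow_le_pow_right (n := 2) (i := 6) (by simp) (by omega)
    rw [Nat.testBit_lt_two_pow (by omega), Nat.testBit_lt_two_pow (by omega)]

lemma boolToF2_injective : Function.Injective boolToF2 := by decide

lemma exists_vec_eq (b : Basis (Fin 6) (ZMod 2) V) (v : V) : ∃ n < 64, vec b n = v := by
  obtain ⟨n, hn, h⟩ := exists_code (b.repr v)
  exact ⟨n, hn, by rw [vec, ← b.sum_repr v]; simp only [h]⟩

lemma vec_injOn (b : Basis (Fin 6) (ZMod 2) V) : Set.InjOn (vec b) {n | n < 64} := by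
  intro n hn k hk h
  refine eq_of_testBit_eq hn hk fun i => boolToF2_injective ?_
  have := congrArg (fun v => b.repr v i) h
  simpa [vec, Finsupp.single_apply] using this

lemma vec_ne_zero (b : Basis (Fin 6) (ZMod 2) V) {n : ℕ} (hn : n < 64) (h0 : n ≠ 0) :
    vec b n ≠ 0 := by
  rw [← vec_zero b]
  exact fun h => h0 (vec_injOn b hn (by simp) h)

lemma map_vec {V' : Type*} [AddCommGroup V'] [Module (ZMod 2) V'] (e : V →ₗ[ZMod 2] V')
    (u : Fin 6 → V) (n : ℕ) : e (vec u n) = vec (fun i => e (u i)) n := by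
  simp [vec]

/-- The points whose code with respect to the basis `b` is a position of a bit of `R`. -/
def pointSet (b : Basis (Fin 6) (ZMod 2) V) (R : ℕ) : Set (ℙ (ZMod 2) V) :=
  {P | ∃ n < 64, R.testBit n ∧ vec b n = P.rep}

lemma vec_mem_vectors_pointSet (b : Basis (Fin 6) (ZMod 2) V) (R : ℕ) {n : ℕ} (hn : n < 64)
    (h0 : n ≠ 0) : vec b n ∈ vectors (pointSet b R) ↔ R.testBit n := by
  constructor
  · rintro ⟨P, ⟨k, hk, hR, h⟩, hP⟩
    rwa [← vec_injOn b hk hn (h.trans hP)]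
  · intro h
    exact ⟨.mk _ _ (vec_ne_zero b hn h0), ⟨n, hn, h, (rep_mk _ _).symm⟩, rep_mk _ _⟩

lemma eq_pointSet {b : Basis (Fin 6) (ZMod 2) V} {R : ℕ} {X : Set (ℙ (ZMod 2) V)}
    (h : ∀ n < 64, n ≠ 0 → (vec b n ∈ vectors X ↔ R.testBit n)) : X = pointSet b R := by
  refine ext_of_vectors fun v => ?_
  obtain ⟨n, hn, rfl⟩ := exists_vec_eq b v
  rcases eq_or_ne n 0 with rfl | h0
  · simp [vec_zero, zero_notMem_vectors]
  · rw [h n hn h0, vec_mem_vectors_pointSet b R hn h0]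

/-! ### Symplectic bases -/

/-- The Gram matrix of `B` on `u` is `m` times the antidiagonal permutation matrix. -/
def IsSymplectic (B : V →ₗ[ZMod 2] V →ₗ[ZMod 2] M) (m : M) (u : Fin 6 → V) : Prop :=
  ∀ i j : Fin 6, B (u i) (u j) = if (i + j : ℕ) = 5 then m else 0

/-- The alternating form on codes. -/
def codeForm (a b : ℕ) : Bool :=
  (a.testBit 0 && b.testBit 5) ^^ (a.testBit 1 && b.testBit 4) ^^ (a.testBit 2 && b.testBit 3) ^^
    (a.testBit 3 && b.testBit 2) ^^ (a.testBit 4 && b.testBit 1) ^^ (a.testBit 5 && b.testBit 0)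

lemma form_vec {B : V →ₗ[ZMod 2] V →ₗ[ZMod 2] M} {m : M} {u : Fin 6 → V}
    (hu : IsSymplectic B m u) (a c : ℕ) :
    B (vec u a) (vec u c) = boolToF2 (codeForm a c) • m := by
  simp only [vec, Fin.sum_univ_six, map_add, map_smul, LinearMap.add_apply, LinearMap.smul_apply,
    hu _ _, codeForm, boolToF2_xor, boolToF2_and, add_smul, mul_smul]
  simp
  module

lemma form_vec_eq_zero {B : V →ₗ[ZMod 2] V →ₗ[ZMod 2] M} {m : M} (hm : m ≠ 0) {u : Fin 6 → V}
    (hu : IsSymplectic B m u) (a c : ℕ) :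
    B (vec u a) (vec u c) = 0 ↔ codeForm a c = false := by
  rw [form_vec hu, ← boolToF2_eq_zero]
  simp [hm]

/-- Pairing a linear relation with the vector at position `5 - j` isolates the coefficient at `j`.
-/
lemma IsSymplectic.linearIndependent {B : V →ₗ[ZMod 2] V →ₗ[ZMod 2] M} {m : M} (hm : m ≠ 0)
    {u : Fin 6 → V} (hu : IsSymplectic B m u) : LinearIndependent (ZMod 2) u := by
  rw [Fintype.linearIndependent_iff]
  intro g hg j
  have h := congrArg (fun v => B v (u j.rev)) hg
  have hs : ∀ i : Fin 6, ((i : ℕ) + (j.rev : ℕ) = 5) ↔ i = j := by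
    intro i; rw [Fin.val_rev, Fin.ext_iff]; omega
  simp only [map_sum, map_smul, LinearMap.sum_apply, LinearMap.smul_apply, hu _ _, hs, map_zero,
    LinearMap.zero_apply] at h
  simpa [hm] using h

lemma IsSymplectic.exists_basis {B : V →ₗ[ZMod 2] V →ₗ[ZMod 2] M} {m : M} (hm : m ≠ 0)
    {u : Fin 6 → V} (hu : IsSymplectic B m u) (hV : finrank (ZMod 2) V = 6) :
    ∃ b : Basis (Fin 6) (ZMod 2) V, ⇑b = u :=
  ⟨basisOfLinearIndependentOfCardEqFinrank (hu.linearIndependent hm) (by simp [hV]), by simp⟩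

/-- The linear map taking one basis to the other preserves codes, and both orthogonality relations
are the same function of the codes. -/
lemma isomorphic_pointSet {V' M' : Type*} [AddCommGroup V'] [Module (ZMod 2) V']
    [AddCommGroup M'] [Module (ZMod 2) M'] {B : V →ₗ[ZMod 2] V →ₗ[ZMod 2] M}
    {B' : V' →ₗ[ZMod 2] V' →ₗ[ZMod 2] M'} {m : M} {m' : M'} (hm : m ≠ 0) (hm' : m' ≠ 0)
    {b : Basis (Fin 6) (ZMod 2) V} {b' : Basis (Fin 6) (ZMod 2) V'}
    (hb : IsSymplectic B m b) (hb' : IsSymplectic B' m' b') (R : ℕ) :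
    Isomorphic B (pointSet b R) B' (pointSet b' R) := by
  have he : ∀ n, b.equiv b' (Equiv.refl _) (vec b n) = vec b' n := by
    intro n
    rw [← LinearEquiv.coe_coe, map_vec]
    simp
  rw [isomorphic_iff]
  refine ⟨b.equiv b' (Equiv.refl _), fun x y => ?_, fun v => ?_⟩
  · obtain ⟨n, -, rfl⟩ := exists_vec_eq b x
    obtain ⟨k, -, rfl⟩ := exists_vec_eq b y
    rw [he, he, form_vec_eq_zero hm hb, form_vec_eq_zero hm' hb']
  · obtain ⟨n, hn, rfl⟩ := exists_vec_eq b v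
    rw [he]
    rcases eq_or_ne n 0 with rfl | h0
    · simp [vec_zero, zero_notMem_vectors]
    · rw [vec_mem_vectors_pointSet b R hn h0, vec_mem_vectors_pointSet b' R hn h0]

end Codes

section Existence

variable {V : Type*} [AddCommGroup V] [Module (ZMod 2) V]

/-- Fewer than six linear conditions on a space of dimension 6 have a common nonzero solution. -/
lemma exists_orthogonal_ne_zero (hV : finrank (ZMod 2) V = 6)
    (B : V →ₗ[ZMod 2] V →ₗ[ZMod 2] ZMod 2) {n : ℕ} (hn : n < 6) (w : Fin n → V) :
    ∃ x ≠ 0, ∀ i, B (w i) x = 0 := by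
  have : FiniteDimensional (ZMod 2) V := .of_finrank_pos (by omega)
  have h : LinearMap.ker (LinearMap.pi fun i => B (w i)) ≠ ⊥ :=
    LinearMap.ker_ne_bot_of_finrank_lt (by simp [hV, hn])
  obtain ⟨x, hx, h0⟩ := Submodule.exists_mem_ne_zero_of_ne_bot h
  exact ⟨x, h0, fun i => congrFun (LinearMap.mem_ker.1 hx) i⟩

/-- Symplectic Gram–Schmidt: hyperbolic pairs are split off one at a time, each new vector being
chosen orthogonal to the pairs found so far. -/
lemma exists_isSymplectic (hV : finrank (ZMod 2) V = 6)
    (B : V →ₗ[ZMod 2] V →ₗ[ZMod 2] ZMod 2) (hB : B.IsAlt) (hB' : LinearMap.Nondegenerate B) :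
    ∃ b : Basis (Fin 6) (ZMod 2) V, IsSymplectic B 1 b := by
  have hs : ∀ x y, B x y = B y x := fun x y => by
    rw [← hB.neg, ZMod.neg_eq_self_mod_two]
  have dual : ∀ x ≠ 0, ∃ y, B x y = 1 := by
    intro x hx
    by_contra! h
    refine hx (hB'.1 x fun y => ?_)
    have : ∀ t : ZMod 2, t ≠ 1 → t = 0 := by decide
    exact this _ (h y)
  have h2 : ∀ t : ZMod 2, t + t = 0 := by decide
  obtain ⟨e₀, h₀, -⟩ := exists_orthogonal_ne_zero hV B (n := 0) (by omega) ![]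
  obtain ⟨f₀, hf₀⟩ := dual e₀ h₀
  obtain ⟨e₁, h₁, o₁⟩ := exists_orthogonal_ne_zero hV B (n := 2) (by omega) ![e₀, f₀]
  obtain ⟨g₁, hg₁⟩ := dual e₁ h₁
  obtain ⟨f₁, hf₁, hf₁', hf₁''⟩ : ∃ f, B e₁ f = 1 ∧ B e₀ f = 0 ∧ B f₀ f = 0 := by
    have a₀ : B e₀ e₁ = 0 := o₁ 0
    have a₁ : B f₀ e₁ = 0 := o₁ 1
    -- The correction terms cancel the pairings of `g₁` with `e₀` and `f₀`. They do not affect the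
    -- pairing with `e₁`, which is orthogonal to both.
    refine ⟨g₁ + B f₀ g₁ • e₀ + B e₀ g₁ • f₀, ?_, ?_, ?_⟩ <;>
      simp [hf₀, hg₁, hB e₀, hB f₀, hs f₀ e₀, hs e₁ e₀, hs e₁ f₀, a₀, a₁, h2]
  obtain ⟨e₂, hh₂, o₂⟩ := exists_orthogonal_ne_zero hV B (n := 4) (by omega) ![e₀, f₀, e₁, f₁]
  obtain ⟨g₂, hg₂⟩ := dual e₂ hh₂
  have a₀ : B e₀ e₁ = 0 := o₁ 0
  have a₁ : B f₀ e₁ = 0 := o₁ 1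
  have c₀ : B e₀ e₂ = 0 := o₂ 0
  have c₁ : B f₀ e₂ = 0 := o₂ 1
  have c₂ : B e₁ e₂ = 0 := o₂ 2
  have c₃ : B f₁ e₂ = 0 := o₂ 3
  obtain ⟨f₂, k₀, k₁, k₂, k₃, k₄⟩ : ∃ f, B e₂ f = 1 ∧ B e₀ f = 0 ∧ B f₀ f = 0 ∧ B e₁ f = 0 ∧
      B f₁ f = 0 := by
    refine ⟨g₂ + B f₀ g₂ • e₀ + B e₀ g₂ • f₀ + B f₁ g₂ • e₁ + B e₁ g₂ • f₁,
      ?_, ?_, ?_, ?_, ?_⟩ <;>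
      simp [hf₀, hg₂, hf₁, hf₁', hf₁'', hB e₀, hB f₀, hB e₁, hB f₁, hs f₀ e₀, hs f₁ e₁, hs e₁ e₀,
        hs e₁ f₀, hs f₁ e₀, hs f₁ f₀, hs e₂ e₀, hs e₂ f₀, hs e₂ e₁, hs e₂ f₁, a₀, a₁, c₀, c₁, c₂,
        c₃, h2]
  -- The reversed order of the `f`s puts dual vectors at positions whose sum is 5.
  have hu : IsSymplectic B 1 ![e₀, e₁, e₂, f₂, f₁, f₀] := by
    intro i j
    fin_cases i <;> fin_cases j <;>
      simp [hf₀, hf₁, hf₁', hf₁'', hB e₀, hB f₀, hB e₁, hB f₁, hB e₂, hB f₂, hs f₀ e₀, hs f₁ e₁,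
        hs e₁ e₀, hs e₁ f₀, hs f₁ e₀, hs f₁ f₀, hs e₂ e₀, hs e₂ f₀, hs e₂ e₁, hs e₂ f₁,
        hs f₂ e₀, hs f₂ f₀, hs f₂ e₁, hs f₂ f₁, hs f₂ e₂, a₀, a₁, c₀, c₁, c₂, c₃,
        k₀, k₁, k₂, k₃, k₄]
  obtain ⟨b, hb⟩ := hu.exists_basis one_ne_zero hV
  exact ⟨b, hb ▸ hu⟩

end Existence

/-! ### Generators -/

section Generators

variable {V : Type*} [AddCommGroup V] [Module (ZMod 2) V] {B : V →ₗ[ZMod 2] V →ₗ[ZMod 2] ZMod 2}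

/-- A totally isotropic subspace lies in its orthogonal space, and the two dimensions add up to 6.
-/
lemma finrank_le_three (hV : finrank (ZMod 2) V = 6) (hB : LinearMap.Nondegenerate B)
    {g : Submodule (ZMod 2) V} (hg : IsTotallyIsotropic B g) : finrank (ZMod 2) g ≤ 3 := by
  have : FiniteDimensional (ZMod 2) V := .of_finrank_pos (by omega)
  have h : g ≤ LinearMap.BilinForm.orthogonal B g := fun y hy x hx => hg x hx y hy
  have h₁ := Submodule.finrank_mono h
  have h₂ := Submodule.finrank_le g
  rw [LinearMap.BilinForm.finrank_orthogonal hB] at h₁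
  omega

/-- The codes of the points of the plane spanned by three points. -/
def planePoints (a b c : ℕ) : List ℕ := [a, b, a ^^^ b, c, a ^^^ c, b ^^^ c, a ^^^ b ^^^ c]

/-- The codes `a`, `b`, `c` span a totally isotropic plane. -/
def isPlane (a b c : ℕ) : Bool :=
  a < 64 && b < 64 && c < 64 && decide (0 :: planePoints a b c).Nodup &&
    !codeForm a b && !codeForm a c && !codeForm b c

/-- The subspace spanned by the vectors with codes `a`, `b`, `c`. -/
def planeSpan (u : Fin 6 → V) (a b c : ℕ) : Submodule (ZMod 2) V :=
  Submodule.span (ZMod 2) {vec u a, vec u b, vec u c}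

lemma mem_planeSpan {u : Fin 6 → V} {a b c : ℕ} {v : V} :
    v ∈ planeSpan u a b c ↔ ∃ n ∈ 0 :: planePoints a b c, vec u n = v := by
  rw [planeSpan, Submodule.mem_span_triple]
  constructor
  · have h01 : ∀ t : ZMod 2, t = 0 ∨ t = 1 := by decide
    rintro ⟨r, s, t, rfl⟩
    rcases h01 r with rfl | rfl <;> rcases h01 s with rfl | rfl <;>
      rcases h01 t with rfl | rfl <;>
      simp [planePoints, vec_xor, vec_zero]
  · rintro ⟨n, hn, rfl⟩
    simp only [planePoints, List.mem_cons, List.not_mem_nil, or_false] at hn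
    rcases hn with rfl | rfl | rfl | rfl | rfl | rfl | rfl | rfl
    exacts [⟨0, 0, 0, by simp [vec_zero]⟩, ⟨1, 0, 0, by simp⟩, ⟨0, 1, 0, by simp⟩,
      ⟨1, 1, 0, by simp [vec_xor]⟩, ⟨0, 0, 1, by simp⟩, ⟨1, 0, 1, by simp [vec_xor]⟩,
      ⟨0, 1, 1, by simp [vec_xor]⟩, ⟨1, 1, 1, by simp [vec_xor]⟩]

lemma xor_lt_sixtyFour {a b : ℕ} (ha : a < 64) (hb : b < 64) : a ^^^ b < 64 :=
  Nat.xor_lt_two_pow (n := 6) ha hb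

lemma lt_of_mem_planePoints {a b c n : ℕ} (ha : a < 64) (hb : b < 64) (hc : c < 64)
    (hn : n ∈ 0 :: planePoints a b c) : n < 64 := by
  have hab := xor_lt_sixtyFour ha hb
  simp only [planePoints, List.mem_cons, List.not_mem_nil, or_false] at hn
  rcases hn with rfl | rfl | rfl | rfl | rfl | rfl | rfl | rfl <;>
    first | assumption | exact xor_lt_sixtyFour (by assumption) (by assumption) | simp

lemma isPlane_iff {a b c : ℕ} : isPlane a b c ↔ (a < 64 ∧ b < 64 ∧ c < 64) ∧
    (0 :: planePoints a b c).Nodup ∧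
    codeForm a b = false ∧ codeForm a c = false ∧ codeForm b c = false := by
  simp [isPlane, and_assoc]

lemma isTotallyIsotropic_planeSpan {b : Fin 6 → V} (hb : IsSymplectic B 1 b) (hB : B.IsAlt)
    {x y z : ℕ} (hxy : codeForm x y = false) (hxz : codeForm x z = false)
    (hyz : codeForm y z = false) : IsTotallyIsotropic B (planeSpan b x y z) := by
  have h := fun a c => form_vec_eq_zero (one_ne_zero' (ZMod 2)) hb a c
  have h₁ := (h _ _).2 hxy
  have h₂ := (h _ _).2 hxz
  have h₃ := (h _ _).2 hyz
  have hs : ∀ v w, B v w = 0 → B w v = 0 := fun v w => hB.isRefl v w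
  intro v hv w hw
  rw [planeSpan, Submodule.mem_span_triple] at hv hw
  obtain ⟨r, s, t, rfl⟩ := hv
  obtain ⟨r', s', t', rfl⟩ := hw
  simp [h₁, h₂, h₃, hs _ _ h₁, hs _ _ h₂, hs _ _ h₃, hB _]

lemma card_planeSpan (b : Basis (Fin 6) (ZMod 2) V) {x y z : ℕ} (h : isPlane x y z) :
    Nat.card (planeSpan b x y z) = 8 := by
  rw [isPlane_iff] at h
  have hset : ((planeSpan b x y z : Submodule (ZMod 2) V) : Set V) =
      vec b '' ((0 :: planePoints x y z).toFinset : Finset ℕ) := by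
    ext v
    simp [mem_planeSpan]
  have hinj : Set.InjOn (vec b) ((0 :: planePoints x y z).toFinset : Finset ℕ) :=
    (vec_injOn b).mono fun n hn =>
      lt_of_mem_planePoints h.1.1 h.1.2.1 h.1.2.2 (by simpa using hn)
  change Nat.card ((planeSpan b x y z : Submodule (ZMod 2) V) : Set V) = 8
  rw [hset, Nat.card_image_of_injOn hinj, Nat.card_coe_set_eq, Set.ncard_coe_finset,
    List.toFinset_card_of_nodup h.2.1]
  rfl

lemma finrank_planeSpan (b : Basis (Fin 6) (ZMod 2) V) {x y z : ℕ} (h : isPlane x y z) :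
    finrank (ZMod 2) (planeSpan b x y z) = 3 := by
  have : Module.Finite (ZMod 2) V := .of_basis b
  have h8 := card_planeSpan b h
  rw [Module.natCard_eq_pow_finrank (K := ZMod 2), Nat.card_zmod] at h8
  exact Nat.pow_right_injective le_rfl (h8.trans (by norm_num : 8 = 2 ^ 3))

/-- The bound 3 is attained by the span of the first three basis vectors, which have the codes 1, 2,
4. -/
lemma isGenerator_iff (hB : B.IsAlt) (hB' : LinearMap.Nondegenerate B)
    {b : Basis (Fin 6) (ZMod 2) V} (hb : IsSymplectic B 1 b) {g : Submodule (ZMod 2) V} :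
    IsGenerator B g ↔ IsTotallyIsotropic B g ∧ finrank (ZMod 2) g = 3 := by
  have hV : finrank (ZMod 2) V = 6 := by simp [finrank_eq_card_basis b]
  have h₀ : isPlane 1 2 4 := by decide
  have h₁ := (isPlane_iff.1 h₀).2.2
  constructor
  · rintro ⟨hg, hmax⟩
    refine ⟨hg, le_antisymm (finrank_le_three hV hB' hg) ?_⟩
    rw [← finrank_planeSpan b h₀]
    exact hmax _ (isTotallyIsotropic_planeSpan hb hB h₁.1 h₁.2.1 h₁.2.2)
  · rintro ⟨hg, h3⟩
    exact ⟨hg, fun g' hg' => h3 ▸ finrank_le_three hV hB' hg'⟩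

lemma isGenerator_planeSpan (hB : B.IsAlt) (hB' : LinearMap.Nondegenerate B)
    {b : Basis (Fin 6) (ZMod 2) V} (hb : IsSymplectic B 1 b) {x y z : ℕ} (h : isPlane x y z) :
    IsGenerator B (planeSpan b x y z) := by
  have h₁ := (isPlane_iff.1 h).2.2
  exact (isGenerator_iff hB hB' hb).2
    ⟨isTotallyIsotropic_planeSpan hb hB h₁.1 h₁.2.1 h₁.2.2, finrank_planeSpan b h⟩

open Classical in
lemma encard_inter_planeSpan (b : Basis (Fin 6) (ZMod 2) V) {x y z : ℕ} (h : isPlane x y z)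
    (X : Set (ℙ (ZMod 2) V)) :
    {P ∈ X | P.submodule ≤ planeSpan b x y z}.encard =
      ((planePoints x y z).countP fun n => vec b n ∈ vectors X : ℕ) := by
  rw [isPlane_iff] at h
  have hset : {v ∈ vectors X | v ∈ planeSpan b x y z} =
      vec b '' (((planePoints x y z).filter fun n => vec b n ∈ vectors X).toFinset :
        Finset ℕ) := by
    ext v
    simp only [Set.mem_ofPred_eq, mem_planeSpan, List.coe_toFinset, List.mem_filter,
      decide_eq_true_eq, Set.mem_image, List.mem_cons]
    constructor
    · rintro ⟨hv, n, rfl | hn, rfl⟩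
      · exact absurd (vec_zero b ▸ hv) (zero_notMem_vectors X)
      · exact ⟨n, ⟨hn, hv⟩, rfl⟩
    · rintro ⟨n, ⟨hn, hv⟩, rfl⟩
      exact ⟨hv, n, .inr hn, rfl⟩
  rw [encard_points_le, hset, Set.InjOn.encard_image, Set.encard_coe_eq_coe_finsetCard,
    List.toFinset_card_of_nodup, List.countP_eq_length_filter]
  · exact (h.2.1.of_cons).filter _
  · refine (vec_injOn b).mono fun n hn => ?_
    simp only [List.coe_toFinset, List.mem_filter, Set.mem_ofPred_eq] at hn
    exact lt_of_mem_planePoints h.1.1 h.1.2.1 h.1.2.2 (List.mem_cons_of_mem _ hn.1)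

/-- Each totally isotropic plane is spanned by points with codes in echelon form. -/
lemma exists_planeSpan_eq {b : Basis (Fin 6) (ZMod 2) V} (hb : IsSymplectic B 1 b)
    {g : Submodule (ZMod 2) V} (hg : IsTotallyIsotropic B g) (h3 : finrank (ZMod 2) g = 3) :
    ∃ x y z, isPlane x y z ∧ g = planeSpan b x y z ∧ x < y ∧ y < x ^^^ y ∧ y < z ∧
      z < x ^^^ z ∧ z < y ^^^ z := by
  have : Module.Finite (ZMod 2) V := .of_basis b
  have h8 : Nat.card g = 8 := by
    rw [Module.natCard_eq_pow_finrank (K := ZMod 2), Nat.card_zmod, h3]; rfl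
  -- The subspace has 8 vectors, too many to be contained in the span of two.
  have key : ∀ x y, ∃ n, (n < 64 ∧ vec b n ∈ g) ∧ n ∉ [0, x, y, x ^^^ y] := by
    intro x y
    by_contra! h
    have hsub : (g : Set V) ⊆ vec b '' ([0, x, y, x ^^^ y].toFinset : Finset ℕ) := by
      intro v hv
      obtain ⟨n, hn, rfl⟩ := exists_vec_eq b v
      exact ⟨n, by simpa using h n ⟨hn, hv⟩, rfl⟩
    have h₁ := Nat.card_mono (Set.toFinite _) hsub
    have h₂ := (Set.ncard_image_le (Finset.finite_toSet _) (f := vec b)).trans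
      (Set.ncard_coe_finset [0, x, y, x ^^^ y].toFinset).le
    have h₃ := List.toFinset_card_le [0, x, y, x ^^^ y]
    rw [← Nat.card_coe_set_eq] at h₂
    change Nat.card g ≤ _ at h₁
    simp only [List.length_cons, List.length_nil] at h₃
    omega
  have hmin : ∀ x y, ∃ n, ((n < 64 ∧ vec b n ∈ g) ∧ n ∉ [0, x, y, x ^^^ y]) ∧
      ∀ k, k < 64 ∧ vec b k ∈ g → k ∉ [0, x, y, x ^^^ y] → n ≤ k := by
    classical
    intro x y
    exact ⟨Nat.find (key x y), Nat.find_spec (key x y), fun k h₁ h₂ =>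
      Nat.find_min' (key x y) ⟨h₁, h₂⟩⟩
  have hxor : ∀ {m n}, m < 64 ∧ vec b m ∈ g → n < 64 ∧ vec b n ∈ g →
      (m ^^^ n) < 64 ∧ vec b (m ^^^ n) ∈ g := fun hm hn =>
    ⟨xor_lt_sixtyFour hm.1 hn.1, by rw [vec_xor]; exact g.add_mem hm.2 hn.2⟩
  -- The codes are chosen greedily: each is the least one in `g` outside the span of the previous
  -- ones. The arguments 0 fill the places of vectors not yet chosen. Minimality yields the
  -- inequalities, which are strict because the codes differ.
  obtain ⟨x, ⟨hx, hx0⟩, hxm⟩ := hmin 0 0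
  obtain ⟨y, ⟨hy, hy0⟩, hym⟩ := hmin x 0
  obtain ⟨z, ⟨hz, hz0⟩, hzm⟩ := hmin x y
  simp only [Nat.xor_zero, List.mem_cons, List.not_mem_nil, or_false, or_self, not_or] at *
  have e₁ : ∀ m n : ℕ, m ^^^ n = 0 ↔ m = n := fun m n => Nat.xor_eq_zero_iff
  have e₂ : ∀ m n : ℕ, m ^^^ n = m ↔ n = 0 := fun m n => by
    rw [← e₁, Nat.xor_comm m n, Nat.xor_assoc, Nat.xor_self, Nat.xor_zero]
  have e₃ : ∀ m n : ℕ, m ^^^ n = n ↔ m = 0 := fun m n => by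
    rw [← e₁, Nat.xor_assoc, Nat.xor_self, Nat.xor_zero]
  have e₄ : ∀ k m n : ℕ, m ^^^ n = k ↔ n = m ^^^ k := fun k m n => by
    constructor
    · rintro rfl; rw [← Nat.xor_assoc, Nat.xor_self, Nat.zero_xor]
    · rintro rfl; rw [← Nat.xor_assoc, Nat.xor_self, Nat.zero_xor]
  have hform : ∀ m n, vec b m ∈ g → vec b n ∈ g → codeForm m n = false := fun m n hm hn =>
    (form_vec_eq_zero (one_ne_zero' (ZMod 2)) hb m n).1 (hg _ hm _ hn)
  have hxy : x ≤ y := hxm y hy hy0.1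
  have hyxy : y ≤ x ^^^ y := hym _ (hxor hx hy) (by grind)
  have hyz : y ≤ z := hym z hz (by tauto)
  have hzxz : z ≤ x ^^^ z := hzm _ (hxor hx hz) (by grind)
  have hzyz : z ≤ y ^^^ z := hzm _ (hxor hy hz) (by grind)
  have hplane : isPlane x y z := by
    rw [isPlane_iff]
    refine ⟨⟨hx.1, hy.1, hz.1⟩, ?_, hform _ _ hx.2 hy.2, hform _ _ hx.2 hz.2,
      hform _ _ hy.2 hz.2⟩
    have x_ne := hx0
    have y_ne := hy0
    have z_ne := hz0
    clear * - x_ne y_ne z_ne e₁ e₂ e₃ e₄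
    simp only [planePoints, List.nodup_cons, List.mem_cons, List.not_mem_nil, or_false, not_or,
      List.nodup_nil, and_true, not_false_eq_true]
    have f₁ : x ^^^ y ≠ 0 := fun h => y_ne.2.1 ((e₁ _ _).1 h).symm
    have f₂ : x ^^^ z ≠ 0 := fun h => z_ne.2.1 ((e₁ _ _).1 h).symm
    have f₃ : y ^^^ z ≠ 0 := fun h => z_ne.2.2.1 ((e₁ _ _).1 h).symm
    have f₄ : x ^^^ (y ^^^ z) ≠ 0 := fun h => z_ne.2.2.2 <| by
      rw [← Nat.xor_assoc, e₁] at h; exact h.symm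
    and_intros <;> intro h <;> rw [← e₁] at h <;>
      try simp only [Nat.xor_comm, Nat.xor_left_comm, Nat.xor_self,
        Nat.xor_xor_cancel_left, Nat.xor_zero] at h
    all_goals tauto
  refine ⟨x, y, z, hplane, ?_, by grind, by grind, by grind, by grind, by grind⟩
  symm
  refine Submodule.eq_of_le_of_finrank_eq ?_ ((finrank_planeSpan b hplane).trans h3.symm)
  rw [planeSpan, Submodule.span_le]
  rintro v (rfl | rfl | rfl)
  exacts [hx.2, hy.2, hz.2]

end Generators

/-! ### Kernel-checked case distinctions -/

/-- The code of the image of the vector with code `n` under the linear map sending the `i`-th basis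
vector to the vector with code `g[i]`. -/
def applyCode (g : List ℕ) (n : ℕ) : ℕ :=
  (bif n.testBit 0 then g.getD 0 0 else 0) ^^^ (bif n.testBit 1 then g.getD 1 0 else 0) ^^^
    (bif n.testBit 2 then g.getD 2 0 else 0) ^^^ (bif n.testBit 3 then g.getD 3 0 else 0) ^^^
    (bif n.testBit 4 then g.getD 4 0 else 0) ^^^ (bif n.testBit 5 then g.getD 5 0 else 0)

/-- The map given by `g` preserves the alternating form. -/
def isSymplecticCode (g : List ℕ) : Bool :=
  (List.range 6).all fun i => (List.range 6).all fun j =>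
    codeForm (g.getD i 0) (g.getD j 0) == decide (i + j = 5)

/-- The map given by `g` preserves the sets of codes encoded by `i` and `o`. -/
def stabilizes (g : List ℕ) (i o : ℕ) : Bool :=
  (List.range 64).all fun n => decide (applyCode g n < 64) &&
    (!i.testBit n || i.testBit (applyCode g n)) && (!o.testBit n || o.testBit (applyCode g n))

/-- The set encoded by `i` together with the elements of `l`. -/
def addBits (i : ℕ) (l : List ℕ) : ℕ := l.foldl (fun i n => i ||| 2 ^ n) i

/-- If `i` already has `m` points of a totally isotropic plane, or `o` already has `7 - m` of them,
then the remaining points of the plane are added to `o` or to `i`, respectively. -/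
def forcePlane (m : ℕ) (s : ℕ × ℕ) (p : ℕ × ℕ × ℕ) : ℕ × ℕ :=
  let l := planePoints p.1 p.2.1 p.2.2
  bif isPlane p.1 p.2.1 p.2.2 then
    bif decide (m ≤ l.countP s.1.testBit) then (s.1, addBits s.2 (l.filter (!s.1.testBit ·)))
    else bif decide (7 - m ≤ l.countP s.2.testBit) then
      (addBits s.1 (l.filter (!s.2.testBit ·)), s.2)
    else s
  else s

/-- Some part of the orbit of the elements of `acc` under the maps in `gens`. An item `(n, j)` of the
list adds the image of `n` under the `j`-th map, if `n` has been reached before. -/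
def orbitCodes (gens : List (List ℕ)) (acc : List ℕ) : List (ℕ × ℕ) → List ℕ
  | [] => acc
  | (n, j) :: l => match gens[j]? with
    | some g => bif acc.contains n then orbitCodes gens (applyCode g n :: acc) l
      else orbitCodes gens acc l
    | none => orbitCodes gens acc l

/-- A case distinction on the codes of a set of points, of which the codes in `i` are known to be
present and the codes in `o` are known to be absent. -/
inductive CaseTree
  /-- A totally isotropic plane has too many present or too many absent points. -/
  | refute (p : ℕ × ℕ × ℕ)
  /-- The set is determined, and `g` maps it to a given one. -/
  | leaf (k : ℕ) (g : List ℕ)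
  /-- Some totally isotropic planes determine further points. -/
  | force (l : List (ℕ × ℕ × ℕ)) (t : CaseTree)
  /-- Either some point of an orbit, and then without loss of generality the point `n`, is present, or
  all points of the orbit are absent. -/
  | split (n : ℕ) (gens : List (List ℕ)) (orbit : List (ℕ × ℕ)) (t₁ t₂ : CaseTree)

/-- The case distinction is complete, and all its cases are refuted or lead to a set in `R`. -/
def CaseTree.check (R : List ℕ) (m : ℕ) : CaseTree → ℕ → ℕ → Bool
  | .refute (a, b, c), i, o => isPlane a b c &&
      (decide (m < (planePoints a b c).countP i.testBit) ||
        decide (7 - m < (planePoints a b c).countP o.testBit))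
  | .leaf k g, i, o => decide (k < R.length) && isSymplecticCode g &&
      (List.range 64).all fun n => n == 0 || (decide (applyCode g n < 64) &&
        bif (R.getD k 0).testBit n then i.testBit (applyCode g n) else o.testBit (applyCode g n))
  | .force l t, i, o =>
      t.check R m (l.foldl (forcePlane m) (i, o)).1 (l.foldl (forcePlane m) (i, o)).2
  | .split n gens l t₁ t₂, i, o =>
      (gens.all fun g => isSymplecticCode g && stabilizes g i o) &&
        t₁.check R m (addBits i [n]) o && t₂.check R m i (addBits o (orbitCodes gens [n] l))

/-- A case tree without leaves for `m = 1`. -/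
def noOneOvoidTree : CaseTree :=
  .split 1 [[15, 26, 14, 38, 13, 58], [39, 63, 57, 9, 11, 3]] [(1, 0), (1, 1), (15, 0), (15, 1),
      (39, 0), (39, 1), (61, 0), (61, 1), (40, 0), (40, 1), (33, 0), (33, 1), (34, 0), (34, 1),
      (16, 0), (16, 1), (31, 0), (31, 1), (28, 0), (28, 1), (10, 1), (53, 1), (36, 0), (36, 1),
      (32, 1), (60, 1), (13, 1), (11, 0), (11, 1), (48, 0), (48, 1), (35, 0), (35, 1), (37, 1),
      (59, 0), (59, 1), (54, 1), (52, 0), (52, 1), (58, 1), (3, 0), (3, 1), (23, 1), (17, 0),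
      (17, 1), (55, 1), (8, 0), (8, 1), (47, 0), (47, 1), (27, 1), (14, 0), (57, 0), (62, 0),
      (21, 0), (42, 0), (2, 1), (44, 0), (41, 0), (41, 1), (38, 0), (6, 0)]
  (
   .force [(1, 2, 4), (1, 8, 16), (1, 14, 20), (1, 10, 22), (1, 12, 18)] <|
   .split 32 [[1, 19, 8, 5, 3, 56], [1, 7, 29, 2, 13, 41]] [(32, 0), (32, 1), (56, 0), (56, 1),
       (41, 0), (41, 1), (62, 0), (38, 0), (38, 1), (60, 0), (60, 1), (42, 0), (42, 1), (37, 0),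
       (37, 1), (35, 1), (51, 1), (49, 0), (53, 0), (47, 0), (47, 1), (34, 0), (58, 0), (58, 1),
       (50, 0), (48, 1), (45, 0), (45, 1), (33, 0), (40, 0), (55, 1)]
   (
    .force [(2, 4, 32), (8, 16, 32), (14, 20, 32), (10, 22, 32), (12, 18, 32)] <|
    .split 35 [[1, 10, 30, 28, 12, 32], [32, 30, 24, 12, 14, 1]] [(35, 0), (35, 1), (43, 0), (43,
        1), (63, 0), (55, 0), (55, 1), (51, 0), (51, 1), (41, 0), (41, 1), (39, 0), (49, 1), (61,
        1)]
    (
     .force [(2, 4, 33)] <|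
     .refute (2, 13, 37)
    ) (
     .refute (2, 13, 37)
    )
   ) (
    .refute (2, 4, 32)
   )
  ) (
   .refute (1, 2, 4)
  )

/-- A case tree without leaves for `m = 2`. -/
def noTwoOvoidTree : CaseTree :=
  .split 1 [[15, 26, 14, 38, 13, 58], [39, 63, 57, 9, 11, 3]] [(1, 0), (1, 1), (15, 0), (15, 1),
      (39, 0), (39, 1), (61, 0), (61, 1), (40, 0), (40, 1), (33, 0), (33, 1), (34, 0), (34, 1),
      (16, 0), (16, 1), (31, 0), (31, 1), (28, 0), (28, 1), (10, 1), (53, 1), (36, 0), (36, 1),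
      (32, 1), (60, 1), (13, 1), (11, 0), (11, 1), (48, 0), (48, 1), (35, 0), (35, 1), (37, 1),
      (59, 0), (59, 1), (54, 1), (52, 0), (52, 1), (58, 1), (3, 0), (3, 1), (23, 1), (17, 0),
      (17, 1), (55, 1), (8, 0), (8, 1), (47, 0), (47, 1), (27, 1), (14, 0), (57, 0), (62, 0),
      (21, 0), (42, 0), (2, 1), (44, 0), (41, 0), (41, 1), (38, 0), (6, 0)]
  (
   .split 2 [[1, 15, 25, 2, 6, 37], [1, 7, 29, 2, 13, 41]] [(2, 0), (2, 1), (15, 0), (15, 1), (7,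
       0), (7, 1), (21, 0), (21, 1), (25, 0), (25, 1), (23, 1), (27, 0), (27, 1), (30, 0), (17,
       1), (5, 0), (5, 1), (14, 0), (22, 0), (10, 0), (9, 0), (12, 1), (24, 0), (28, 0), (16, 0),
       (13, 0), (31, 0), (26, 0), (26, 1)]
   (
    .force [(1, 2, 4), (1, 2, 8), (1, 2, 12)] <|
    .split 16 [[2, 1, 15, 6, 39, 24], [1, 2, 9, 12, 19, 46]] [(16, 0), (16, 1), (39, 0), (39, 1),
        (20, 0), (20, 1), (36, 0), (40, 0), (40, 1), (26, 0), (26, 1), (23, 0), (23, 1), (30, 0),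
        (34, 1), (32, 0), (32, 1), (43, 1), (25, 0), (47, 0), (44, 0), (24, 1), (46, 1), (35, 0),
        (35, 1), (18, 0), (17, 0), (31, 1), (41, 0), (45, 1), (38, 0)]
    (
     .force [(1, 4, 16), (1, 8, 16), (1, 12, 16)] <|
     .split 32 [[1, 16, 13, 4, 2, 36], [1, 2, 9, 13, 16, 36]] [(32, 0), (36, 0), (36, 1), (41,
         0), (41, 1), (45, 0), (33, 0)]
     (
      .force [(2, 4, 32), (8, 16, 32), (2, 12, 32), (4, 17, 34), (4, 18, 33)] <|
      .refute (11, 22, 37)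
     ) (
      .split 22 [[1, 16, 9, 4, 2, 36], [1, 2, 8, 12, 16, 33]] [(22, 0), (22, 1), (27, 0), (27,
          1), (26, 1)]
      (
       .force [(1, 4, 18), (5, 18, 41), (5, 17, 42)] <|
       .refute (2, 5, 40)
      ) (
       .refute (1, 14, 22)
      )
     )
    ) (
     .refute (1, 4, 16)
    )
   ) (
    .refute (1, 2, 4)
   )
  ) (
   .refute (1, 2, 4)
  )

/-- A case tree for `m = 3`. -/
def threeOvoidTree : CaseTree :=
  .split 1 [[15, 26, 14, 38, 13, 58], [39, 63, 57, 9, 11, 3]] [(1, 0), (1, 1), (15, 0), (15, 1),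
      (39, 0), (39, 1), (61, 0), (61, 1), (40, 0), (40, 1), (33, 0), (33, 1), (34, 0), (34, 1),
      (16, 0), (16, 1), (31, 0), (31, 1), (28, 0), (28, 1), (10, 1), (53, 1), (36, 0), (36, 1),
      (32, 1), (60, 1), (13, 1), (11, 0), (11, 1), (48, 0), (48, 1), (35, 0), (35, 1), (37, 1),
      (59, 0), (59, 1), (54, 1), (52, 0), (52, 1), (58, 1), (3, 0), (3, 1), (23, 1), (17, 0),
      (17, 1), (55, 1), (8, 0), (8, 1), (47, 0), (47, 1), (27, 1), (14, 0), (57, 0), (62, 0),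
      (21, 0), (42, 0), (2, 1), (44, 0), (41, 0), (41, 1), (38, 0), (6, 0)]
  (
   .split 2 [[1, 15, 25, 2, 6, 37], [1, 7, 29, 2, 13, 41]] [(2, 0), (2, 1), (15, 0), (15, 1), (7,
       0), (7, 1), (21, 0), (21, 1), (25, 0), (25, 1), (23, 1), (27, 0), (27, 1), (30, 0), (17,
       1), (5, 0), (5, 1), (14, 0), (22, 0), (10, 0), (9, 0), (12, 1), (24, 0), (28, 0), (16, 0),
       (13, 0), (31, 0), (26, 0), (26, 1)]
   (
    .split 16 [[2, 1, 15, 6, 39, 24], [1, 2, 9, 12, 19, 46]] [(16, 0), (16, 1), (39, 0), (39, 1),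
        (20, 0), (20, 1), (36, 0), (40, 0), (40, 1), (26, 0), (26, 1), (23, 0), (23, 1), (30, 0),
        (34, 1), (32, 0), (32, 1), (43, 1), (25, 0), (47, 0), (44, 0), (24, 1), (46, 1), (35, 0),
        (35, 1), (18, 0), (17, 0), (31, 1), (41, 0), (45, 1), (38, 0)]
    (
     .split 6 [[1, 16, 13, 4, 2, 36], [1, 2, 9, 13, 16, 36]] [(6, 0), (6, 1), (29, 0), (29, 1),
         (11, 1), (10, 0), (10, 1), (21, 1), (14, 0), (15, 1), (25, 1)]
     (
      .force [(1, 2, 4)] <|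
      .split 8 [[1, 2, 4, 9, 16, 36], [1, 6, 4, 24, 16, 32], [1, 6, 4, 29, 16, 36]] [(8, 0), (8,
          1), (8, 2), (9, 1), (9, 2), (24, 2), (25, 2)]
      (
       .force [(1, 8, 16), (1, 2, 8)] <|
       .split 38 [[1, 2, 4, 8, 16, 33], [1, 8, 24, 2, 6, 33]] [(38, 0), (38, 1), (39, 1)]
       (
        .force [(2, 4, 32)] <|
        .split 21 [[2, 1, 9, 6, 38, 24]] [(21, 0)]
        (
         .force [(1, 4, 16), (4, 16, 32), (8, 16, 32), (2, 8, 32)] <|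
         .split 37 [[8, 16, 32, 1, 2, 4]] [(37, 0)]
         (
          .force [(2, 4, 33), (9, 17, 39), (2, 13, 37), (2, 9, 37), (4, 17, 35), (15, 23, 39),
              (4, 19, 35)] <|
          .split 14 [] []
          (
           .force [(1, 14, 20), (14, 23, 35), (1, 2, 12), (1, 14, 22), (15, 22, 36), (1, 4, 18),
               (2, 8, 33), (2, 12, 33)] <|
           .split 28 [[46, 2, 39, 14, 52, 35]] [(28, 0), (29, 0), (51, 0), (59, 0), (53, 0), (30,
               0), (31, 0), (49, 0), (57, 0)]
           (
            .force [(1, 12, 16), (7, 26, 41), (7, 25, 42), (1, 12, 18), (7, 25, 43), (4, 16, 33),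
                (7, 27, 43), (8, 16, 33), (11, 23, 39), (12, 16, 32), (15, 23, 38)] <|
            .leaf 2 [4, 16, 53, 5, 3, 60]
           ) (
            .refute (1, 12, 16)
           )
          ) (
           .force [(14, 23, 34), (1, 2, 12), (1, 12, 16), (3, 12, 48), (1, 14, 22), (1, 4, 18),
               (4, 16, 33), (4, 18, 33)] <|
           .split 26 [[23, 48, 4, 63, 53, 3]] [(26, 0), (58, 0), (57, 0), (30, 0), (62, 0)]
           (
            .force [(1, 8, 18), (7, 26, 41), (2, 8, 33), (7, 25, 43), (1, 12, 18), (7, 25, 42),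
                (2, 12, 33), (8, 16, 33), (11, 23, 38), (12, 16, 33), (15, 23, 38)] <|
            .leaf 2 [3, 6, 57, 56, 13, 29]
           ) (
            .refute (11, 21, 39)
           )
          )
         ) (
          .force [(2, 9, 37), (13, 19, 39), (7, 25, 43), (2, 8, 33), (15, 21, 39), (10, 21, 34),
              (7, 27, 43), (15, 20, 37), (6, 27, 34), (12, 17, 35), (2, 12, 33), (11, 23, 38),
              (1, 4, 18), (7, 25, 42), (7, 27, 42), (11, 23, 39), (12, 16, 32)] <|
          .leaf 2 [5, 18, 63, 4, 17, 54]
         )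
        ) (
         .force [(4, 17, 34), (9, 16, 36), (1, 4, 16), (2, 9, 36), (4, 16, 32), (9, 17, 38)] <|
         .split 12 [[16, 1, 9, 20, 52, 10]] [(12, 0), (29, 0), (57, 0), (58, 0), (43, 0)]
         (
          .force [(1, 2, 12), (12, 16, 33), (7, 27, 42), (1, 8, 18), (1, 4, 18), (3, 4, 49), (7,
              26, 40), (15, 22, 37), (13, 18, 37), (8, 17, 35), (15, 23, 39), (13, 19, 39), (5,
              16, 41), (2, 12, 32), (8, 16, 32), (11, 23, 39)] <|
          .leaf 2 [3, 8, 58, 59, 13, 18]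
         ) (
          .force [(11, 22, 36), (4, 18, 33), (9, 18, 36), (1, 8, 18), (12, 18, 32), (5, 18, 40),
              (1, 14, 22), (1, 2, 12), (2, 13, 37), (13, 16, 37), (1, 12, 16), (1, 12, 18), (11,
              20, 37), (12, 19, 35), (2, 8, 33), (11, 23, 39)] <|
          .leaf 1 [5, 23, 44, 4, 7, 48]
         )
        )
       ) (
        .force [(3, 4, 49), (3, 4, 48), (9, 17, 38), (7, 26, 40), (15, 23, 39), (1, 2, 12), (10,
            23, 35), (7, 24, 41), (1, 12, 16), (1, 6, 26), (1, 6, 24), (4, 19, 35), (12, 19, 34),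
            (1, 4, 18), (4, 17, 35), (1, 4, 16), (12, 19, 35)] <|
        .split 32 [[1, 2, 4, 8, 16, 33]] [(32, 0)]
        (
         .force [(2, 4, 32), (2, 8, 32), (2, 13, 37), (2, 4, 33), (2, 8, 33), (2, 12, 32), (2,
             12, 33), (8, 16, 32), (8, 16, 33), (11, 23, 38), (11, 23, 39)] <|
         .leaf 2 [3, 6, 63, 61, 10, 33]
        ) (
         .force [(2, 4, 33), (2, 8, 32)] <|
         .refute (2, 13, 37)
        )
       )
      ) (
       .force [(1, 8, 16), (1, 4, 16)] <|
       .split 32 [[1, 6, 4, 28, 17, 39], [1, 2, 4, 12, 16, 33]] [(32, 0), (32, 1), (39, 0), (39,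
           1), (36, 0), (36, 1), (35, 1)]
       (
        .force [(2, 4, 32), (4, 17, 34)] <|
        .split 40 [[1, 6, 4, 28, 16, 32], [1, 2, 4, 12, 16, 32]] [(40, 0), (40, 1), (60, 1)]
        (
         .force [(2, 8, 32), (8, 16, 32), (3, 8, 48), (4, 16, 32)] <|
         .split 30 [[16, 32, 8, 4, 1, 2]] [(30, 0)]
         (
          .force [(1, 10, 20), (7, 25, 42), (7, 27, 42), (1, 6, 26), (2, 9, 36), (13, 17, 39),
              (9, 16, 36), (12, 16, 33), (10, 20, 32)] <|
          .split 14 [[16, 52, 9, 4, 17, 55]] [(14, 0), (57, 0), (50, 0), (18, 0), (37, 0)]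
          (
           .force [(2, 12, 32), (2, 5, 41), (14, 22, 33), (5, 19, 42), (1, 2, 12), (15, 23, 39),
               (14, 23, 35), (1, 4, 18), (2, 4, 33), (4, 16, 33), (7, 25, 43)] <|
           .leaf 2 [8, 1, 16, 3, 56, 5]
          ) (
           .force [(1, 2, 12), (1, 8, 18), (2, 4, 33), (2, 12, 32), (4, 19, 35), (10, 23, 34),
               (1, 4, 18), (7, 26, 41), (2, 8, 33), (11, 23, 38), (12, 16, 32)] <|
           .leaf 2 [3, 6, 61, 60, 10, 28]
          )
         ) (
          .refute (7, 25, 42)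
         )
        ) (
         .force [(13, 16, 37), (2, 4, 33), (4, 17, 35), (4, 18, 32), (1, 4, 18), (5, 16, 41), (5,
             16, 40), (4, 16, 33), (8, 16, 32), (4, 16, 32)] <|
         .split 10 [[32, 2, 4, 40, 16, 37], [17, 55, 4, 24, 16, 48]] [(10, 0), (10, 1), (42, 0),
             (42, 1), (47, 0), (15, 0), (15, 1), (31, 0), (14, 0), (30, 0), (30, 1), (46, 0),
             (46, 1), (59, 0), (27, 0)]
         (
          .force [(1, 2, 8), (2, 8, 32), (2, 13, 37), (1, 2, 12), (2, 8, 33), (2, 12, 32), (2,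
              12, 33), (7, 25, 42), (1, 12, 18), (7, 26, 41), (1, 8, 18), (11, 23, 38), (11, 23,
              39), (15, 23, 38), (15, 23, 39)] <|
          .leaf 1 [5, 16, 45, 4, 7, 49]
         ) (
          .refute (1, 2, 8)
         )
        )
       ) (
        .refute (2, 4, 32)
       )
      )
     ) (
      .force [(1, 14, 22), (1, 4, 18), (1, 14, 20), (1, 8, 18), (1, 10, 20), (1, 12, 18), (1, 2,
          4), (1, 4, 16)] <|
      .split 32 [[1, 26, 7, 18, 31, 40], [1, 3, 12, 9, 16, 60]] [(32, 0), (32, 1), (40, 0), (40,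
          1), (60, 0), (60, 1), (58, 0), (58, 1), (53, 0), (53, 1), (34, 0), (41, 0), (41, 1),
          (63, 0), (63, 1), (38, 1), (49, 0), (49, 1), (33, 1), (50, 1), (59, 0), (59, 1), (52,
          0), (57, 0), (43, 1), (51, 0), (51, 1), (54, 0), (54, 1), (45, 1), (56, 0)]
      (
       .split 36 [[1, 26, 20, 6, 30, 32], [1, 2, 6, 10, 30, 32]] [(36, 0), (36, 1), (52, 0), (52,
           1), (38, 0), (42, 0), (42, 1), (60, 0), (60, 1)]
       (
        .force [(2, 4, 32), (4, 16, 32), (4, 19, 35), (2, 4, 33), (4, 16, 33), (4, 18, 32), (4,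
            18, 33)] <|
        .split 40 [[1, 17, 4, 24, 22, 55], [1, 22, 4, 28, 17, 55]] [(40, 0), (40, 1), (47, 0),
            (47, 1), (43, 0), (43, 1), (59, 0), (59, 1), (56, 0), (56, 1), (60, 0), (60, 1), (41,
            0), (41, 1), (58, 1)]
        (
         .force [(2, 8, 32), (7, 25, 42), (5, 16, 40), (5, 19, 43), (2, 5, 41), (5, 16, 41), (5,
             18, 41), (5, 18, 40), (2, 12, 33)] <|
         .leaf 1 [6, 1, 30, 4, 33, 18]
        ) (
         .refute (2, 8, 32)
        )
       ) (
        .force [(2, 13, 37), (2, 4, 33), (2, 8, 33), (2, 12, 33), (2, 4, 32), (4, 16, 32), (7,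
            25, 42), (7, 25, 43), (4, 16, 33), (3, 8, 49), (3, 12, 49), (7, 27, 42), (7, 27, 43),
            (11, 23, 39), (15, 23, 39)] <|
        .leaf 0 [4, 1, 2, 16, 32, 8]
       )
      ) (
       .refute (2, 4, 32)
      )
     )
    ) (
     .force [(4, 16, 32), (1, 2, 4)] <|
     .refute (1, 4, 16)
    )
   ) (
    .refute (1, 2, 4)
   )
  ) (
   .refute (1, 2, 4)
  )

/-- Against an empty list every leaf fails the check, so success means that all branches end in a
contradiction. The tree is only a certificate; its origin plays no role in the argument. -/
theorem noOneOvoidTree_check : noOneOvoidTree.check [] 1 0 0 = true := by decide +kernel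

theorem noTwoOvoidTree_check : noTwoOvoidTree.check [] 2 0 0 = true := by decide +kernel

/-- The codes of the points of the elliptic quadric `x₀² + x₀x₅ + x₅² + x₁x₄ + x₂x₃ = 0`. -/
def ellipticCode : ℕ := 4381140422086993236

/-- The codes of the points of the quadric of the first construction. -/
def pencilCode : ℕ := 14065602556405897812

/-- The codes of the points of the `3`-ovoid of the second construction. -/
def gluedCode : ℕ := 5633267561022371412

theorem threeOvoidTree_check :
    threeOvoidTree.check [ellipticCode, pencilCode, gluedCode] 3 0 0 = true := by decide +kernel

/-! ### Soundness of the case distinctions -/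

section Soundness

variable {V : Type*} [AddCommGroup V] [Module (ZMod 2) V] {B : V →ₗ[ZMod 2] V →ₗ[ZMod 2] ZMod 2}

lemma testBit_addBits (i : ℕ) (l : List ℕ) (n : ℕ) :
    (addBits i l).testBit n ↔ i.testBit n ∨ n ∈ l := by
  induction l generalizing i with
  | nil => simp [addBits]
  | cons a l ih =>
    rw [addBits, List.foldl_cons, ← addBits, ih]
    simp only [Nat.testBit_or, Nat.testBit_two_pow, Bool.or_eq_true, decide_eq_true_eq,
      List.mem_cons, or_assoc, @eq_comm _ a n]

lemma vec_cond (u : Fin 6 → V) (t : Bool) (n : ℕ) :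
    vec u (bif t then n else 0) = boolToF2 t • vec u n := by
  cases t <;> simp [boolToF2, vec_zero]

lemma vec_applyCode (u : Fin 6 → V) (g : List ℕ) (n : ℕ) :
    vec (fun i : Fin 6 => vec u (g.getD i 0)) n = vec u (applyCode g n) := by
  simp only [applyCode, vec_xor, vec_cond]
  rw [vec, Fin.sum_univ_six]
  rfl

lemma IsSymplectic.applyCode {u : Fin 6 → V} (hu : IsSymplectic B 1 u) {g : List ℕ}
    (hg : isSymplecticCode g) : IsSymplectic B 1 fun i : Fin 6 => vec u (g.getD i 0) := by
  intro i j
  simp only [isSymplecticCode, List.all_eq_true, List.mem_range, beq_iff_eq] at hg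
  rw [form_vec hu, hg i i.2 j j.2]
  by_cases h : (i + j : ℕ) = 5 <;> simp [h, boolToF2]

lemma exists_basis_applyCode {b : Basis (Fin 6) (ZMod 2) V} (hb : IsSymplectic B 1 b) {g : List ℕ}
    (hg : isSymplecticCode g) : ∃ b' : Basis (Fin 6) (ZMod 2) V, IsSymplectic B 1 b' ∧
      ∀ n, vec b' n = vec b (applyCode g n) := by
  obtain ⟨b', hb'⟩ := (hb.applyCode hg).exists_basis one_ne_zero (by simp [finrank_eq_card_basis b])
  exact ⟨b', hb' ▸ hb.applyCode hg, fun n => hb' ▸ vec_applyCode _ _ _⟩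

/-- The codes in `i` are those of points of `X`, and the codes in `o` are not. -/
def IsConsistent (b : Basis (Fin 6) (ZMod 2) V) (X : Set (ℙ (ZMod 2) V)) (i o : ℕ) : Prop :=
  ∀ n < 64, (i.testBit n → vec b n ∈ vectors X) ∧ (o.testBit n → vec b n ∉ vectors X)

-- A generator has seven points, so the number of absent points is fixed as well. This makes the
-- roles of present and absent points symmetric in the search.
open Classical in
lemma countP_plane {m : ℕ} {X : Set (ℙ (ZMod 2) V)} (hB : B.IsAlt)
    (hB' : LinearMap.Nondegenerate B) (hX : IsMOvoid B m X) {b : Basis (Fin 6) (ZMod 2) V}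
    (hb : IsSymplectic B 1 b) {x y z : ℕ} (h : isPlane x y z) :
    ((planePoints x y z).countP fun n => vec b n ∈ vectors X) = m ∧
      ((planePoints x y z).countP fun n => vec b n ∉ vectors X) = 7 - m := by
  have h₁ := hX _ (isGenerator_planeSpan hB hB' hb h)
  rw [encard_inter_planeSpan b h, Nat.cast_inj] at h₁
  refine ⟨h₁, ?_⟩
  have h₂ := List.length_eq_countP_add_countP (l := planePoints x y z)
    (fun n => decide (vec b n ∈ vectors X))
  simp only [h₁, decide_eq_true_eq] at h₂
  have h₃ : (planePoints x y z).length = 7 := rfl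
  simp only [decide_not] at h₂ ⊢
  omega

lemma countP_lt_countP {α : Type*} {l : List α} {p q : α → Bool} (h : ∀ x ∈ l, p x → q x) {a : α}
    (ha : a ∈ l) (hq : q a) (hp : p a = false) : l.countP p < l.countP q := by
  induction l with
  | nil => simp at ha
  | cons x l ih =>
    have hle : l.countP p ≤ l.countP q := List.countP_mono_left fun y hy => h y (by simp [hy])
    rcases List.mem_cons.1 ha with rfl | ha
    · rw [List.countP_cons_of_pos hq, List.countP_cons_of_neg (by simp [hp])]
      omega
    · have := ih (fun y hy => h y (by simp [hy])) ha
      have hx := h x (by simp)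
      rw [List.countP_cons, List.countP_cons]
      split_ifs <;> first | omega | simp_all

section

variable {m : ℕ} {X : Set (ℙ (ZMod 2) V)} (hB : B.IsAlt) (hB' : LinearMap.Nondegenerate B)
  (hX : IsMOvoid B m X) {b : Basis (Fin 6) (ZMod 2) V} (hb : IsSymplectic B 1 b)

include hB hB' hX hb

/-- If `m` points of a generator are known to be present, one further present point would push the
count strictly above `m`. The same argument applies to absent points and `7 - m`. -/
lemma IsConsistent.forcePlane {s : ℕ × ℕ} (hs : IsConsistent b X s.1 s.2) (p : ℕ × ℕ × ℕ) :
    IsConsistent b X (forcePlane m s p).1 (forcePlane m s p).2 := by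
  classical
  unfold SymplecticOvoid.forcePlane
  cases hp : isPlane p.1 p.2.1 p.2.2
  · exact hs
  obtain ⟨h₁, h₂⟩ := countP_plane hB hB' hX hb hp
  have hlt : ∀ n ∈ planePoints p.1 p.2.1 p.2.2, n < 64 := fun n hn => by
    rw [isPlane_iff] at hp
    exact lt_of_mem_planePoints hp.1.1 hp.1.2.1 hp.1.2.2 (List.mem_cons_of_mem _ hn)
  simp only [cond_true]
  by_cases hi : m ≤ (planePoints p.1 p.2.1 p.2.2).countP s.1.testBit
  · simp only [hi, decide_true, cond_true]
    refine fun n hn => ⟨(hs n hn).1, fun h hv => ?_⟩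
    rw [testBit_addBits, List.mem_filter] at h
    rcases h with h | ⟨hl, h⟩
    · exact (hs n hn).2 h hv
    · have := countP_lt_countP (p := s.1.testBit) (q := fun n => decide (vec b n ∈ vectors X))
        (fun k hk hki => by simpa using (hs k (hlt k hk)).1 hki) hl (by simpa using hv)
        (by simpa using h)
      omega
  · simp only [hi, decide_false, cond_false]
    by_cases ho : 7 - m ≤ (planePoints p.1 p.2.1 p.2.2).countP s.2.testBit
    · simp only [ho, decide_true, cond_true]
      refine fun n hn => ⟨fun h => ?_, (hs n hn).2⟩
      rw [testBit_addBits, List.mem_filter] at h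
      rcases h with h | ⟨hl, h⟩
      · exact (hs n hn).1 h
      · by_contra hv
        have := countP_lt_countP (p := s.2.testBit) (q := fun n => decide (vec b n ∉ vectors X))
          (fun k hk hki => by simpa using (hs k (hlt k hk)).2 hki) hl (by simpa using hv)
          (by simpa using h)
        omega
    · simpa only [ho, decide_false, cond_false] using hs

lemma IsConsistent.foldl_forcePlane {s : ℕ × ℕ} (hs : IsConsistent b X s.1 s.2)
    (l : List (ℕ × ℕ × ℕ)) : IsConsistent b X (l.foldl (SymplecticOvoid.forcePlane m) s).1
      (l.foldl (SymplecticOvoid.forcePlane m) s).2 := by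
  induction l generalizing s with
  | nil => exact hs
  | cons p l ih => exact ih (hs.forcePlane hB hB' hX hb p)

-- Only this closure principle is needed of `orbitCodes`; that the list exhausts an orbit is never
-- used.
omit hB hB' hX hb in
lemma of_mem_orbitCodes {gens : List (List ℕ)} {P : ℕ → Prop}
    (hP : ∀ g ∈ gens, ∀ n, P n → P (SymplecticOvoid.applyCode g n)) (l : List (ℕ × ℕ))
    {acc : List ℕ} (hacc : ∀ n ∈ acc, P n) : ∀ n ∈ orbitCodes gens acc l, P n := by
  induction l generalizing acc with
  | nil => exact hacc
  | cons a l ih =>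
    obtain ⟨n, j⟩ := a
    rw [orbitCodes]
    cases hg : gens[j]? with
    | none => exact ih hacc
    | some g =>
      cases hn : acc.contains n
      · exact ih hacc
      · refine ih fun k hk => ?_
        rcases List.mem_cons.1 hk with rfl | hk
        · exact hP g (List.mem_of_getElem? hg) n (hacc n (by simpa using hn))
        · exact hacc k hk

-- Symmetry is exploited by changing the basis and keeping `X` fixed, so the induction has to
-- quantify over all symplectic bases in which the current knowledge is correct.
omit hb in
theorem CaseTree.exists_eq_pointSet {R : List ℕ} (t : CaseTree) :
    ∀ {i o : ℕ}, t.check R m i o → ∀ {b : Basis (Fin 6) (ZMod 2) V}, IsSymplectic B 1 b →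
      IsConsistent b X i o → ∃ r ∈ R, ∃ b' : Basis (Fin 6) (ZMod 2) V, IsSymplectic B 1 b' ∧
        X = pointSet b' r := by
  classical
  induction t with
  | refute p =>
    intro i o ht b hb hc
    obtain ⟨x, y, z⟩ := p
    rw [check, Bool.and_eq_true, Bool.or_eq_true, decide_eq_true_eq, decide_eq_true_eq] at ht
    obtain ⟨hp, h⟩ := ht
    obtain ⟨h₁, h₂⟩ := countP_plane hB hB' hX hb hp
    have hlt : ∀ n ∈ planePoints x y z, n < 64 := fun n hn => by
      rw [isPlane_iff] at hp
      exact lt_of_mem_planePoints hp.1.1 hp.1.2.1 hp.1.2.2 (List.mem_cons_of_mem _ hn)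
    have h₃ := List.countP_mono_left (l := planePoints x y z) (p := i.testBit)
      (q := fun n => decide (vec b n ∈ vectors X))
      fun k hk hki => by simpa using (hc k (hlt k hk)).1 hki
    have h₄ := List.countP_mono_left (l := planePoints x y z) (p := o.testBit)
      (q := fun n => decide (vec b n ∉ vectors X))
      fun k hk hki => by simpa using (hc k (hlt k hk)).2 hki
    omega
  | leaf k g =>
    intro i o ht b hb hc
    simp only [check, Bool.and_eq_true, decide_eq_true_eq, List.all_eq_true, List.mem_range,
      Bool.or_eq_true, beq_iff_eq] at ht
    obtain ⟨⟨hk, hg⟩, h⟩ := ht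
    obtain ⟨b', hb', hv⟩ := exists_basis_applyCode hb hg
    refine ⟨R.getD k 0, by simp [hk], b', hb', eq_pointSet fun n hn h0 => ?_⟩
    obtain ⟨hlt, h⟩ := (h n hn).resolve_left h0
    rw [hv]
    cases hR : (R.getD k 0).testBit n <;> rw [hR] at h
    · simpa using (hc _ hlt).2 h
    · simpa using (hc _ hlt).1 h
  | force l t ih =>
    intro i o ht b hb hc
    exact ih ht hb (IsConsistent.foldl_forcePlane hB hB' hX hb (s := (i, o)) hc l)
  | split n gens l t₁ t₂ ih₁ ih₂ =>
    intro i o ht b hb hc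
    simp only [check, Bool.and_eq_true, List.all_eq_true] at ht
    obtain ⟨⟨hg, h₁⟩, h₂⟩ := ht
    by_contra hcon
    -- If no listed set fits, then `n` itself is absent in every consistent basis, by the first
    -- subtree. The claim passes from `k` to its image under a generator `g`: the vector with code
    -- `applyCode g k` in `b` has code `k` in the image basis, which is again consistent since `g`
    -- stabilizes the known points.
    have key : ∀ k ∈ orbitCodes gens [n] l, ∀ b : Basis (Fin 6) (ZMod 2) V, IsSymplectic B 1 b →
        IsConsistent b X i o → vec b k ∉ vectors X := by
      refine of_mem_orbitCodes (fun g hgg k hk b hb hc hv => ?_) l ?_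
      · obtain ⟨hs, hst⟩ := hg g hgg
        obtain ⟨b', hb', hv'⟩ := exists_basis_applyCode hb hs
        refine hk b' hb' (fun j hj => ?_) (hv' k ▸ hv)
        simp only [stabilizes, List.all_eq_true, List.mem_range, Bool.and_eq_true,
          decide_eq_true_eq, Bool.or_eq_true, Bool.not_eq_true'] at hst
        obtain ⟨⟨hlt, hi⟩, ho⟩ := hst j hj
        rw [hv']
        exact ⟨fun h => (hc _ hlt).1 (hi.resolve_left (by simp [h])),
          fun h => (hc _ hlt).2 (ho.resolve_left (by simp [h]))⟩
      · intro k hk b hb hc hv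
        obtain rfl := List.mem_singleton.1 hk
        refine hcon (ih₁ h₁ hb fun j hj => ⟨fun h => ?_, (hc j hj).2⟩)
        rw [testBit_addBits] at h
        rcases h with h | h
        · exact (hc j hj).1 h
        · rwa [List.mem_singleton.1 h]
    refine hcon (ih₂ h₂ hb fun j hj => ⟨(hc j hj).1, fun h => ?_⟩)
    rw [testBit_addBits] at h
    rcases h with h | h
    · exact (hc j hj).2 h
    · exact key j h b hb hc

omit hb in
theorem exists_eq_pointSet_of_check {R : List ℕ} (t : CaseTree) (ht : t.check R m 0 0)
    (hb : IsSymplectic B 1 b) :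
    ∃ r ∈ R, ∃ b' : Basis (Fin 6) (ZMod 2) V, IsSymplectic B 1 b' ∧ X = pointSet b' r :=
  t.exists_eq_pointSet hB hB' hX ht hb fun n _ => by simp

end

end Soundness

section Examples

variable {V : Type*} [AddCommGroup V] [Module (ZMod 2) V] {B : V →ₗ[ZMod 2] V →ₗ[ZMod 2] ZMod 2}

/-! ### Checking that a set is a `3`-ovoid -/

/-- All totally isotropic planes contain exactly three points of the set encoded by `R`. -/
def isThreeOvoidCode (R : ℕ) : Bool :=
  (List.range 64).all fun x => (List.range 64).all fun y =>
    !(decide (x < y) && decide (y < x ^^^ y) && !codeForm x y) ||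
      (List.range 64).all fun z =>
        !(decide (y < z) && decide (z < x ^^^ z) && decide (z < y ^^^ z) && !codeForm x z &&
          !codeForm y z) || (planePoints x y z).countP R.testBit == 3

theorem isThreeOvoidCode_ellipticCode : isThreeOvoidCode ellipticCode := by decide +kernel

theorem isThreeOvoidCode_pencilCode : isThreeOvoidCode pencilCode := by decide +kernel

theorem isThreeOvoidCode_gluedCode : isThreeOvoidCode gluedCode := by decide +kernel

/-- Each generator is spanned by a triple in the echelon form of `exists_planeSpan_eq`, so the
finite check may be limited to such triples. -/
theorem isMOvoid_pointSet (hB : B.IsAlt) (hB' : LinearMap.Nondegenerate B)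
    {b : Basis (Fin 6) (ZMod 2) V} (hb : IsSymplectic B 1 b) {R : ℕ} (hR : isThreeOvoidCode R) :
    IsMOvoid B 3 (pointSet b R) := by
  classical
  intro g hg
  rw [isGenerator_iff hB hB' hb] at hg
  obtain ⟨x, y, z, h, rfl, hxy, hxy', hyz, hxz', hyz'⟩ := exists_planeSpan_eq hb hg.1 hg.2
  have hp := isPlane_iff.1 h
  rw [encard_inter_planeSpan b h]
  have hc : ((planePoints x y z).countP fun n => vec b n ∈ vectors (pointSet b R)) =
      (planePoints x y z).countP R.testBit := by
    refine List.countP_congr fun n hn => ?_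
    rw [decide_eq_true_eq, vec_mem_vectors_pointSet b R (lt_of_mem_planePoints hp.1.1 hp.1.2.1
      hp.1.2.2 (List.mem_cons_of_mem _ hn))]
    rintro rfl
    exact (List.nodup_cons.1 hp.2.1).1 hn
  simp only [isThreeOvoidCode, List.all_eq_true, List.mem_range, Bool.or_eq_true,
    Bool.not_eq_true', Bool.and_eq_false_iff, beq_iff_eq] at hR
  have h₁ := (hR x hp.1.1 y hp.1.2.1).resolve_left (by simp [hxy, hxy', hp.2.2.1])
  have h₂ := (h₁ z hp.1.2.2).resolve_left (by simp [hyz, hxz', hyz', hp.2.2.2])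
  rw [hc, h₂]

/-! ### Invariants -/

/-- Whenever two points of `X` are orthogonal, the third point of their line is in `X`. -/
def IsLineClosed (B : V →ₗ[ZMod 2] V →ₗ[ZMod 2] ZMod 2) (X : Set (ℙ (ZMod 2) V)) : Prop :=
  ∀ v ∈ vectors X, ∀ w ∈ vectors X, v ≠ w → B v w = 0 → v + w ∈ vectors X

/-- Each point of `X` is on a totally isotropic line contained in `X`. -/
def IsCoveredByLines (B : V →ₗ[ZMod 2] V →ₗ[ZMod 2] ZMod 2) (X : Set (ℙ (ZMod 2) V)) : Prop :=
  ∀ v ∈ vectors X, ∃ w ∈ vectors X, v ≠ w ∧ B v w = 0 ∧ v + w ∈ vectors X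

lemma IsLineClosed.of_isomorphic {X Y : Set (ℙ (ZMod 2) V)} (hX : IsLineClosed B X)
    (h : Isomorphic B X B Y) : IsLineClosed B Y := by
  obtain ⟨e, he, hv⟩ := isomorphic_iff.1 h
  intro v
  obtain ⟨v, rfl⟩ := e.surjective v
  intro hv' w
  obtain ⟨w, rfl⟩ := e.surjective w
  intro hw' hne h0
  rw [← map_add, ← hv]
  exact hX v ((hv v).2 hv') w ((hv w).2 hw') (fun h => hne (by rw [h])) ((he v w).2 h0)

lemma IsCoveredByLines.of_isomorphic {X Y : Set (ℙ (ZMod 2) V)} (hX : IsCoveredByLines B X)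
    (h : Isomorphic B X B Y) : IsCoveredByLines B Y := by
  obtain ⟨e, he, hv⟩ := isomorphic_iff.1 h
  intro v
  obtain ⟨v, rfl⟩ := e.surjective v
  intro hv'
  obtain ⟨w, hw, hne, h0, hs⟩ := hX v ((hv v).2 hv')
  exact ⟨e w, (hv w).1 hw, e.injective.ne hne, (he v w).1 h0, by rw [← map_add]; exact (hv _).1 hs⟩

/-- The invariant `IsLineClosed` on codes. -/
def isLineClosedCode (R : ℕ) : Bool :=
  (List.range 64).all fun x => !R.testBit x || (List.range 64).all fun y =>
    !(R.testBit y && x != y && !codeForm x y) || R.testBit (x ^^^ y)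

/-- The invariant `IsCoveredByLines` on codes. -/
def isCoveredByLinesCode (R : ℕ) : Bool :=
  (List.range 64).all fun x => !R.testBit x || (List.range 64).any fun y =>
    R.testBit y && x != y && !codeForm x y && R.testBit (x ^^^ y)

/-- With bit 0 cleared, the zero vector, which is not a point, needs no separate treatment. -/
lemma vec_mem_iff (b : Basis (Fin 6) (ZMod 2) V) {R : ℕ} (hR : R.testBit 0 = false) {n : ℕ}
    (hn : n < 64) : vec b n ∈ vectors (pointSet b R) ↔ R.testBit n := by
  rcases eq_or_ne n 0 with rfl | h0
  · simp [vec_zero, zero_notMem_vectors, hR]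
  · exact vec_mem_vectors_pointSet b R hn h0

lemma isLineClosed_pointSet_iff {b : Basis (Fin 6) (ZMod 2) V} (hb : IsSymplectic B 1 b) {R : ℕ}
    (hR : R.testBit 0 = false) : IsLineClosed B (pointSet b R) ↔ isLineClosedCode R := by
  have hm := fun {n : ℕ} => vec_mem_iff b hR (n := n)
  have hf := form_vec_eq_zero (one_ne_zero' (ZMod 2)) hb
  simp only [isLineClosedCode, List.all_eq_true, List.mem_range, Bool.or_eq_true,
    Bool.not_eq_true', Bool.and_eq_false_iff]
  constructor
  · intro h x hx
    refine or_iff_not_imp_left.2 fun h₁ y hy => or_iff_not_imp_left.2 fun h₂ => ?_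
    rw [Bool.not_eq_false] at h₁
    simp only [not_or, Bool.not_eq_false, bne_iff_ne, Bool.not_eq_true'] at h₂
    rw [← hm (xor_lt_sixtyFour hx hy), vec_xor]
    exact h _ ((hm hx).2 h₁) _ ((hm hy).2 h₂.1.1) (fun h => h₂.1.2 (vec_injOn b hx hy h))
      ((hf _ _).2 h₂.2)
  · intro h v hv w hw hne h0
    obtain ⟨x, hx, rfl⟩ := exists_vec_eq b v
    obtain ⟨y, hy, rfl⟩ := exists_vec_eq b w
    rw [hm hx] at hv
    rw [hm hy] at hw
    have hxy : x ≠ y := fun h => hne (by rw [h])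
    rw [← vec_xor, hm (xor_lt_sixtyFour hx hy)]
    exact ((h x hx).resolve_left (by simp [hv]) y hy).resolve_left
      (by simp [hw, hxy, (hf _ _).1 h0])

lemma isCoveredByLines_pointSet_iff {b : Basis (Fin 6) (ZMod 2) V} (hb : IsSymplectic B 1 b)
    {R : ℕ} (hR : R.testBit 0 = false) :
    IsCoveredByLines B (pointSet b R) ↔ isCoveredByLinesCode R := by
  have hm := fun {n : ℕ} => vec_mem_iff b hR (n := n)
  have hf := form_vec_eq_zero (one_ne_zero' (ZMod 2)) hb
  simp only [isCoveredByLinesCode, List.all_eq_true, List.any_eq_true, List.mem_range,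
    Bool.or_eq_true, Bool.and_eq_true, bne_iff_ne, Bool.not_eq_true']
  constructor
  · intro h x hx
    refine or_iff_not_imp_left.2 fun h₁ => ?_
    rw [Bool.not_eq_false] at h₁
    obtain ⟨w, hw, hne, h0, hs⟩ := h _ ((hm hx).2 h₁)
    obtain ⟨y, hy, rfl⟩ := exists_vec_eq b w
    rw [← vec_xor, hm (xor_lt_sixtyFour hx hy)] at hs
    exact ⟨y, hy, ⟨⟨(hm hy).1 hw, fun h => hne (by rw [h])⟩, (hf _ _).1 h0⟩, hs⟩
  · intro h v hv
    obtain ⟨x, hx, rfl⟩ := exists_vec_eq b v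
    rw [hm hx] at hv
    obtain ⟨y, hy, ⟨⟨h₁, h₂⟩, h₃⟩, h₄⟩ := (h x hx).resolve_left (by simp [hv])
    exact ⟨vec b y, (hm hy).2 h₁, fun h => h₂ (vec_injOn b hx hy h), (hf _ _).2 h₃, by
      rw [← vec_xor, hm (xor_lt_sixtyFour hx hy)]; exact h₄⟩

/-- Line closure separates the elliptic quadric from the other two sets: if a quadratic form
polarizing to `B` vanishes at two orthogonal vectors, it vanishes at their sum. Covering by totally
isotropic lines separates those two from each other. -/
theorem isLineClosedCode_ellipticCode : isLineClosedCode ellipticCode = true := by decide +kernel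

theorem isLineClosedCode_pencilCode : isLineClosedCode pencilCode = false := by decide +kernel

theorem isLineClosedCode_gluedCode : isLineClosedCode gluedCode = false := by decide +kernel

theorem isCoveredByLinesCode_pencilCode : isCoveredByLinesCode pencilCode = true := by
  decide +kernel

theorem isCoveredByLinesCode_gluedCode : isCoveredByLinesCode gluedCode = false := by
  decide +kernel

/-! ### Quadratic forms polarizing to the alternating form -/

/-- The quadratic form on codes that takes the values given by the bits of `q` on the basis. -/
def codeQuad (q n : ℕ) : Bool :=
  (q.testBit 0 && n.testBit 0) ^^ (q.testBit 1 && n.testBit 1) ^^ (q.testBit 2 && n.testBit 2) ^^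
    (q.testBit 3 && n.testBit 3) ^^ (q.testBit 4 && n.testBit 4) ^^ (q.testBit 5 && n.testBit 5) ^^
    (n.testBit 0 && n.testBit 5) ^^ (n.testBit 1 && n.testBit 4) ^^ (n.testBit 2 && n.testBit 3)

/-- The images of the basis under the transvection with the given center. -/
def transvectionCode (a : ℕ) : List ℕ :=
  [1, 2, 4, 8, 16, 32].map fun n => bif codeForm a n then n ^^^ a else n

/-- Each of the quadratic forms is mapped by a transvection to the elliptic form or to a form that
vanishes on the first three vectors of the basis and their sums. -/
theorem codeQuad_cases : ((List.range 64).all fun q => (List.range 64).any fun a =>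
    ((List.range 64).all (fun n => n == 0 || (decide (applyCode (transvectionCode a) n < 64) &&
      ellipticCode.testBit n == !codeQuad q (applyCode (transvectionCode a) n))) ||
    (planePoints 1 2 4).all fun n => !codeQuad q (applyCode (transvectionCode a) n)) &&
    isSymplecticCode (transvectionCode a)) = true := by decide +kernel

/-- An element of `𝔽₂` is determined by whether it vanishes, so forms with the same orthogonality
relation are equal. -/
lemma polar_eq {Q : QuadraticForm (ZMod 2) V}
    (hQ : ∀ x y, QuadraticMap.polar Q x y = 0 ↔ B x y = 0) (x y : V) :
    QuadraticMap.polar Q x y = B x y := by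
  have : ∀ s t : ZMod 2, (s = 0 ↔ t = 0) → s = t := by decide
  exact this _ _ (hQ x y)

lemma quadraticForm_vec {Q : QuadraticForm (ZMod 2) V}
    (hQ : ∀ x y, QuadraticMap.polar Q x y = B x y) {u : Fin 6 → V} (hu : IsSymplectic B 1 u) {q : ℕ}
    (hq : ∀ i : Fin 6, boolToF2 (q.testBit i) = Q (u i)) (n : ℕ) :
    Q (vec u n) = boolToF2 (codeQuad q n) := by
  have hsq : ∀ t : Bool, boolToF2 t * boolToF2 t = boolToF2 t := by decide
  simp only [vec, Fin.sum_univ_six, QuadraticMap.map_add Q, hQ, map_add, map_smul,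
    LinearMap.add_apply, LinearMap.smul_apply, hu _ _, QuadraticMap.map_smul, ← hq, hsq, codeQuad,
    boolToF2_xor, boolToF2_and, smul_eq_mul]
  simp
  ring

lemma mem_vectors_zeros (Q : QuadraticForm (ZMod 2) V) {v : V} (hv : v ≠ 0) :
    v ∈ vectors {P : ℙ (ZMod 2) V | Q P.rep = 0} ↔ Q v = 0 := by
  constructor
  · rintro ⟨P, hP, rfl⟩
    exact hP
  · intro h
    refine ⟨.mk _ v hv, ?_, rep_mk v hv⟩
    change Q _ = 0
    rwa [rep_mk]

/-- Two quadratic forms with polar form `B` differ by the square of some `B(·, a)`. If `Q a = 0`,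
composing `Q` with the transvection of center `a` adds exactly this square, so a single transvection
relates two forms of the same type. The search over the 64 forms and all centers in `codeQuad_cases`
confirms this. -/
theorem exists_eq_pointSet_ellipticCode {b : Basis (Fin 6) (ZMod 2) V} (hb : IsSymplectic B 1 b)
    {X : Set (ℙ (ZMod 2) V)} (hX : IsEllipticQuadricPolarizingTo B X) :
    ∃ b' : Basis (Fin 6) (ZMod 2) V, IsSymplectic B 1 b' ∧ X = pointSet b' ellipticCode := by
  obtain ⟨Q, ⟨-, d, hd, hmax⟩, hQ, rfl⟩ := hX
  have hV : finrank (ZMod 2) V = 6 := by simp [finrank_eq_card_basis b]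
  obtain ⟨q, hq, hqQ⟩ := exists_code fun i => Q (b i)
  have hval := quadraticForm_vec (polar_eq hQ) hb hqQ
  have h := codeQuad_cases
  simp only [List.all_eq_true, List.any_eq_true, List.mem_range, Bool.and_eq_true, Bool.or_eq_true,
    beq_iff_eq, decide_eq_true_eq, Bool.not_eq_true'] at h
  obtain ⟨a, -, h, hs⟩ := h q hq
  obtain ⟨b', hb', hv⟩ := exists_basis_applyCode hb hs
  rcases h with h | h
  · refine ⟨b', hb', eq_pointSet fun n hn h0 => ?_⟩
    rw [mem_vectors_zeros Q (vec_ne_zero b' hn h0), hv, hval, boolToF2_eq_zero,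
      ((h n hn).resolve_left h0).2, Bool.not_eq_true']
  -- In the remaining case the form has a totally singular subspace of dimension 3, whereas the
  -- largest have dimension 2.
  · exfalso
    have h3 : 3 ≤ d := by
      refine hmax.2 ⟨planeSpan b' 1 2 4, fun x hx => ?_, finrank_planeSpan b' (by decide)⟩
      obtain ⟨n, hn, rfl⟩ := mem_planeSpan.1 hx
      rcases List.mem_cons.1 hn with rfl | hn
      · rw [vec_zero, QuadraticMap.map_zero]
      · rw [hv, hval, h n hn]; rfl
    omega

theorem isEllipticQuadricPolarizingTo_pointSet (hB : B.IsAlt) (hB' : LinearMap.Nondegenerate B)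
    {b : Basis (Fin 6) (ZMod 2) V} (hb : IsSymplectic B 1 b) :
    IsEllipticQuadricPolarizingTo B (pointSet b ellipticCode) := by
  have hV : finrank (ZMod 2) V = 6 := by simp [finrank_eq_card_basis b]
  have : Module.Finite (ZMod 2) V := .of_basis b
  let c := b.coord
  let Q : QuadraticForm (ZMod 2) V := QuadraticMap.linMulLin (c 0) (c 0) +
    QuadraticMap.linMulLin (c 0) (c 5) + QuadraticMap.linMulLin (c 5) (c 5) +
    QuadraticMap.linMulLin (c 1) (c 4) + QuadraticMap.linMulLin (c 2) (c 3)
  have hc : ∀ n (i : Fin 6), c i (vec b n) = boolToF2 (n.testBit i) := fun n i => by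
    simp [c, vec, Finsupp.single_apply]
  have hQB : ∀ x y, QuadraticMap.polar Q x y = B x y := by
    intro x y
    obtain ⟨n, -, rfl⟩ := exists_vec_eq b x
    obtain ⟨k, -, rfl⟩ := exists_vec_eq b y
    have h2 : (2 : ZMod 2) = 0 := rfl
    rw [form_vec hb]
    simp only [QuadraticMap.polar, Q, add_apply, QuadraticMap.linMulLin_apply, map_add,
      hc, codeForm, boolToF2_xor, boolToF2_and, smul_eq_mul, mul_one]
    simp only [Fin.isValue, Fin.coe_ofNat_eq_mod, Nat.zero_mod, Nat.one_mod, Nat.reduceMod]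
    -- The squares of the coordinates 0 and 5 contribute their cross terms twice, hence nothing in
    -- characteristic 2.
    linear_combination (boolToF2 (n.testBit 0) * boolToF2 (k.testBit 0) +
      boolToF2 (n.testBit 5) * boolToF2 (k.testBit 5)) * h2
  -- Here 33 = 2⁰ + 2⁵: among the basis vectors, `Q` is nonzero exactly at the first and the last.
  have hQ : ∀ n, Q (vec b n) = boolToF2 (codeQuad 33 n) := by
    refine quadraticForm_vec hQB hb fun i => ?_
    simp only [Q, c, add_apply, QuadraticMap.linMulLin_apply, Basis.coord_apply,
      Basis.repr_self]
    fin_cases i <;> simp <;> decide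
  have hcode : ((List.range 64).all fun n => n == 0 || ellipticCode.testBit n == !codeQuad 33 n) =
    true := by decide +kernel
  simp only [List.all_eq_true, List.mem_range, Bool.or_eq_true, beq_iff_eq] at hcode
  have hX : {P : ℙ (ZMod 2) V | Q P.rep = 0} = pointSet b ellipticCode := by
    refine eq_pointSet fun n hn h0 => ?_
    rw [mem_vectors_zeros Q (vec_ne_zero b hn h0), hQ, boolToF2_eq_zero,
      (hcode n hn).resolve_left h0, Bool.not_eq_true']
  refine ⟨Q, ⟨?_, 2, hV, ?_, ?_⟩, fun x y => by rw [hQB], hX.symm⟩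
  · rwa [show QuadraticMap.polarBilin Q = B from LinearMap.ext₂ hQB]
  · refine ⟨Submodule.span (ZMod 2) (Set.range (b ∘ ![1, 2])), fun x hx => ?_, ?_⟩
    · have h01 : ∀ t : ZMod 2, t = 0 ∨ t = 1 := by decide
      rw [Set.range_comp, show Set.range ![(1 : Fin 6), 2] = {1, 2} by simp [Set.pair_comm],
        Set.image_pair, Submodule.mem_span_pair] at hx
      obtain ⟨r, s, rfl⟩ := hx
      simp only [Q, c, add_apply, QuadraticMap.linMulLin_apply, Basis.coord_apply,
        map_add, map_smul, Basis.repr_self]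
      simp
    · rw [finrank_span_eq_card (b.linearIndependent.comp _ (by decide))]
      rfl
  · rintro d ⟨U, hU, rfl⟩
    -- A totally singular subspace is totally isotropic. One of dimension 3 would be a generator
    -- with all seven points in the set, but the set is a `3`-ovoid.
    have hiso : IsTotallyIsotropic B U := fun x hx y hy => by
      rw [← hQB, QuadraticMap.polar, hU _ (U.add_mem hx hy), hU _ hx, hU _ hy]; simp
    by_contra hlt
    have h3 : finrank (ZMod 2) U = 3 := le_antisymm (finrank_le_three hV hB' hiso) (by omega)
    have hg := isMOvoid_pointSet hB hB' hb isThreeOvoidCode_ellipticCode U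
      ((isGenerator_iff hB hB' hb).2 ⟨hiso, h3⟩)
    obtain ⟨x, y, z, h, rfl, -⟩ := exists_planeSpan_eq hb hiso h3
    classical
    rw [← hX, encard_inter_planeSpan b h, Nat.cast_inj, List.countP_eq_length.2] at hg
    · exact absurd hg (by simp [planePoints])
    · intro n hn
      have hp := isPlane_iff.1 h
      have hn' := lt_of_mem_planePoints hp.1.1 hp.1.2.1 hp.1.2.2 (List.mem_cons_of_mem _ hn)
      rw [decide_eq_true_eq, mem_vectors_zeros Q (vec_ne_zero b hn' _)]
      · exact hU _ (mem_planeSpan.2 ⟨n, List.mem_cons_of_mem _ hn, rfl⟩)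
      · rintro rfl
        exact (List.nodup_cons.1 hp.2.1).1 hn

end Examples

/-! ### The first construction -/

section Pencil

open Polynomial in
lemma ne_zero_of_irreducible {F : Type*} [Field F] {d : F} (h : Irreducible (X ^ 2 + X + C d : F[X]))
    (t : F) : t ^ 2 + t + d ≠ 0 := by
  intro h0
  have h1 := degree_eq_one_of_irreducible_of_root h (x := t) (by simpa [IsRoot.def] using h0)
  have h2 : (X ^ 2 + X + C d : F[X]).degree = 2 := by compute_degree!
  rw [h2] at h1
  norm_num at h1

lemma isSymplectic_antidiagForm :
    IsSymplectic (antidiagForm (ZMod 2)) 1 (Pi.basisFun (ZMod 2) (Fin 6)) := by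
  intro i j
  rw [antidiagForm, Pi.basisFun_apply, Pi.basisFun_apply, Matrix.toLinearMap₂'_apply']
  rw [Matrix.mulVec_single_one, single_one_dotProduct]
  revert i j
  decide

theorem pencilQuadric_eq : pencilQuadric (1 : ZMod 2) 1 =
    pointSet (Pi.basisFun (ZMod 2) (Fin 6)) pencilCode := by
  have hv : ∀ n, vec (Pi.basisFun (ZMod 2) (Fin 6)) n = fun i : Fin 6 => boolToF2 (n.testBit i) := by
    intro n
    ext i
    simp [vec, Pi.single_apply]
  have hcode : ∀ n < 64, n ≠ 0 →
      (pencilPoly (1 : ZMod 2) 1 (fun i : Fin 6 => boolToF2 (n.testBit i)) = 0 ↔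
        pencilCode.testBit n) := by
    decide +kernel
  refine eq_pointSet fun n hn h0 => ?_
  rw [← hcode n hn h0, ← hv]
  constructor
  · rintro ⟨P, hP, h⟩
    rwa [← h]
  · intro h
    refine ⟨.mk _ _ (vec_ne_zero _ hn h0), ?_, rep_mk _ _⟩
    change pencilPoly _ _ _ = 0
    rwa [rep_mk]

end Pencil

/-! ### Codes for the elements of the field with four elements -/

section FourElements

/-- The product in `𝔽₄`, where `x + 2 y` encodes `x + y ω` with `ω ^ 2 = ω + 1`. -/
def mulCode (a b : ℕ) : ℕ :=
  (bif (a.testBit 0 && b.testBit 0) ^^ (a.testBit 1 && b.testBit 1) then 1 else 0) ^^^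
    (bif (a.testBit 0 && b.testBit 1) ^^ (a.testBit 1 && b.testBit 0) ^^
      (a.testBit 1 && b.testBit 1) then 2 else 0)

/-- The inner product of vectors over `𝔽₄` with six coordinates. -/
def dotCode (v w : List ℕ) : ℕ :=
  mulCode (v.getD 0 0) (w.getD 0 0) ^^^ mulCode (v.getD 1 0) (w.getD 1 0) ^^^
    mulCode (v.getD 2 0) (w.getD 2 0) ^^^ mulCode (v.getD 3 0) (w.getD 3 0) ^^^
    mulCode (v.getD 4 0) (w.getD 4 0) ^^^ mulCode (v.getD 5 0) (w.getD 5 0)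

/-- The matrices `M_{a,b,c,d}`, as lists of rows. -/
def groupMatrixCode (a b c d : ℕ) : List (List ℕ) :=
  -- Squaring is the Frobenius map. As `ω³ = 1`, division by `ω` is multiplication by the code 3,
  -- division by `ω²` is multiplication by the code 2, and `1 / ω^(q + 1)` is 1.
  let f : ℕ → ℕ := fun x => mulCode x x
  [[f a, 0, 0, 0, f c, mulCode (mulCode c (a ^^^ mulCode c 3)) 3],
   [0, f (f a), 0, f (f c), 0, mulCode (mulCode (f c) (f a ^^^ mulCode (f c) 2)) 2],
   [mulCode a b, mulCode (f a) (f b), 1, mulCode (f c) (f d), mulCode c d,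
     mulCode (mulCode d (a ^^^ mulCode c 3)) 3 ^^^
       mulCode (mulCode (f d) (f a ^^^ mulCode (f c) 2)) 2 ^^^ 1],
   [0, f (f b), 0, f (f d), 0, mulCode (mulCode (f d) (f b ^^^ mulCode (f d) 2) ^^^ 2) 2],
   [f b, 0, 0, 0, f d, mulCode (mulCode d (b ^^^ mulCode d 3) ^^^ 3) 3],
   [0, 0, 0, 0, 0, 1]]

/-- The product of a matrix, given as a list of rows, and a vector. -/
def mulVecCode (M : List (List ℕ)) (v : List ℕ) : List ℕ :=
  [dotCode (M.getD 0 []) v, dotCode (M.getD 1 []) v, dotCode (M.getD 2 []) v,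
    dotCode (M.getD 3 []) v, dotCode (M.getD 4 []) v, dotCode (M.getD 5 []) v]

/-- The columns of a matrix. -/
def columnCode (M : List (List ℕ)) (j : ℕ) : List ℕ := M.map fun r => r.getD j 0

/-- The vectors representing the points of the orbit of `S_γ`. -/
def orbitCode : List (List ℕ) :=
  [[1, 1, 0, 1, 1, 1], [1, 1, 0, 2, 3, 1], [1, 1, 1, 1, 1, 1], [1, 1, 1, 2, 3, 1],
   [2, 3, 0, 0, 0, 1], [2, 3, 0, 1, 1, 1], [2, 3, 1, 0, 0, 1], [2, 3, 1, 1, 1, 1],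
   [3, 2, 0, 0, 0, 1], [3, 2, 0, 2, 3, 1], [3, 2, 1, 0, 0, 1], [3, 2, 1, 2, 3, 1]]

/-- The vector `S_γ`. -/
def pointCode (g : ℕ) : List ℕ :=
  [mulCode g 3, mulCode (mulCode g g) 2,
    mulCode (mulCode 3 g) 3 ^^^ mulCode (mulCode 2 (mulCode g g)) 2, 1, 1, 1]

/-- The quadruples with `a d + b c = 1`. -/
def quadruples : List (ℕ × ℕ × ℕ × ℕ) :=
  ((List.range 4).flatMap fun a => (List.range 4).flatMap fun b => (List.range 4).flatMap fun c =>
    (List.range 4).map fun d => (a, b, c, d)).filter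
      fun (a, b, c, d) => mulCode a d ^^^ mulCode b c == 1

/-- The twelve listed vectors are closed under all generators, so they contain the orbit of `S_γ`;
`orbitCode_transitive` gives the converse. -/
theorem mulVecCode_mem_orbitCode : ∀ t ∈ quadruples, ∀ v ∈ orbitCode,
    mulVecCode (groupMatrixCode t.1 t.2.1 t.2.2.1 t.2.2.2) v ∈ orbitCode := by
  decide +kernel

/-- The matrices multiply compatibly with inversion in `SL(2, 4)`, where in characteristic 2 the
inverse is obtained by exchanging `a` and `d`. -/
theorem groupMatrixCode_mul : ∀ t ∈ quadruples, ∀ i < 6, ∀ j < 6,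
    dotCode ((groupMatrixCode t.1 t.2.1 t.2.2.1 t.2.2.2).getD i [])
      (columnCode (groupMatrixCode t.2.2.2 t.2.1 t.2.2.1 t.1) j) = if i = j then 1 else 0 := by
  decide +kernel

theorem swap_mem_quadruples : ∀ t ∈ quadruples, (t.2.2.2, t.2.1, t.2.2.1, t.1) ∈ quadruples := by
  decide +kernel

theorem pointCode_mem : ∀ g ∈ [2, 3], pointCode g ∈ orbitCode := by decide +kernel

/-- A single generator already takes `S_γ` to each vector of the list, so no longer products are
needed. -/
theorem orbitCode_transitive : ∀ g ∈ [2, 3], ∀ v ∈ orbitCode, ∃ t ∈ quadruples,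
    mulVecCode (groupMatrixCode t.1 t.2.1 t.2.2.1 t.2.2.2) (pointCode g) = v := by
  decide +kernel

/-- The Gram matrix of the Hermitian form. -/
def hermCode : List (List ℕ) :=
  [[0, 0, 0, 2, 0, 3], [0, 0, 0, 0, 3, 2], [0, 0, 0, 0, 0, 1], [3, 0, 0, 0, 0, 0],
   [0, 2, 0, 0, 0, 0], [2, 3, 1, 0, 0, 0]]

/-- A symplectic basis of the Baer subgeometry. -/
def baerBasisCode : List (List ℕ) :=
  [[0, 0, 0, 0, 0, 1], [0, 0, 0, 1, 1, 0], [0, 0, 0, 2, 3, 0], [3, 2, 1, 0, 0, 0],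
   [1, 1, 1, 0, 0, 0], [0, 0, 1, 0, 0, 0]]

/-- The `j`-th coordinate of the sum of the vectors of the basis given by the bits of `n`. -/
def baerCoordCode (n j : ℕ) : ℕ :=
  let s : ℕ → ℕ := fun i => bif n.testBit i then (baerBasisCode.getD i []).getD j 0 else 0
  s 0 ^^^ s 1 ^^^ s 2 ^^^ s 3 ^^^ s 4 ^^^ s 5

/-- The code represents the zero of `𝔽₄`. -/
def isZeroCode (n : ℕ) : Bool := !n.testBit 0 && !n.testBit 1

theorem baerBasisCode_form : ∀ i < 6, ∀ j < 6,
    dotCode (baerBasisCode.getD i []) (mulVecCode hermCode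
      ((baerBasisCode.getD j []).map fun x => mulCode x x)) = if i + j = 5 then 1 else 0 := by
  decide +kernel

theorem exists_baerCoordCode : ∀ a < 4, ∀ b < 4, ∀ d₀ < 2, ∀ d₁ < 2, ∃ n < 64, ∀ j < 6,
    baerCoordCode n j = [a, mulCode a a, d₀, b, mulCode b b, d₁].getD j 0 := by
  decide +kernel

/-- The vector with code `n` represents a point of the `3`-ovoid of the second construction. -/
def isGluedCode (n : ℕ) : Bool :=
  (isZeroCode (baerCoordCode n 5) && isZeroCode (mulCode (baerCoordCode n 2) (baerCoordCode n 2) ^^^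
    mulCode (baerCoordCode n 0) (baerCoordCode n 4) ^^^
    mulCode (baerCoordCode n 1) (baerCoordCode n 3))) ||
  orbitCode.any fun v => (List.range 6).all fun j => isZeroCode (baerCoordCode n j ^^^ v.getD j 0)

theorem isGluedCode_eq : ∀ n < 64, n ≠ 0 → gluedCode.testBit n = isGluedCode n := by
  decide +kernel

variable {L : Type*} [Field L]

/-- The map `φ` decodes the elements of a field with four elements. -/
structure IsDecoding (φ : ℕ → L) : Prop where
  map_xor : ∀ a b, φ (a ^^^ b) = φ a + φ b
  map_mul : ∀ a b, φ (mulCode a b) = φ a * φ b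
  map_one : φ 1 = 1
  eq_zero_iff : ∀ a, φ a = 0 ↔ isZeroCode a
  surjective : ∀ x, ∃ n < 4, φ n = x

namespace IsDecoding

variable {φ : ℕ → L} (hφ : IsDecoding φ)

include hφ

lemma map_zero : φ 0 = 0 := (hφ.eq_zero_iff 0).2 (by decide)

lemma three_mul_two : φ 3 * φ 2 = 1 := by
  rw [← hφ.map_mul, ← hφ.map_one]; rfl

lemma inv_two : (φ 2)⁻¹ = φ 3 := inv_eq_of_mul_eq_one_left hφ.three_mul_two

lemma inv_three : (φ 3)⁻¹ = φ 2 := by rw [← hφ.inv_two, inv_inv]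

lemma map_dotCode (v w : List ℕ) :
    φ (dotCode v w) = ∑ i : Fin 6, φ (v.getD i 0) * φ (w.getD i 0) := by
  simp only [dotCode, hφ.map_xor, hφ.map_mul, Fin.sum_univ_six]
  rfl

end IsDecoding

variable [Algebra (ZMod 2) L]

/-- The elements 1 and `ω` are independent over `𝔽₂` and `ω² = ω + 1`, so the two low bits of a code
serve as coordinates. Four distinct values fill a field with four elements. -/
lemma exists_isDecoding {ω : L} (hL : Nat.card L = 4)
    (hω : ω ∉ Set.range (algebraMap (ZMod 2) L)) (h1 : ω + ω ^ 2 = 1) :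
    ∃ φ : ℕ → L, IsDecoding φ ∧ φ 2 = ω := by
  have : CharP L 2 := charP_of_injective_algebraMap (algebraMap (ZMod 2) L).injective 2
  have h2 : (2 : L) = 0 := CharTwo.two_eq_zero
  have hsq : ω ^ 2 = ω + 1 := by linear_combination h1 - ω * h2
  let s : Bool → L := fun b => algebraMap (ZMod 2) L (boolToF2 b)
  have sx : ∀ a b, s (a ^^ b) = s a + s b := fun a b => by simp [s, boolToF2_xor]
  have sm : ∀ a b, s (a && b) = s a * s b := fun a b => by simp [s, boolToF2_and]
  have s0 : s false = 0 := by simp [s, boolToF2]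
  have s1 : s true = 1 := by simp [s, boolToF2]
  let φ : ℕ → L := fun n => s (n.testBit 0) + s (n.testBit 1) * ω
  have hxor : ∀ a b, φ (a ^^^ b) = φ a + φ b := fun a b => by
    simp only [φ, Nat.testBit_xor, sx]; ring
  have hzero : ∀ a, φ a = 0 ↔ isZeroCode a := by
    intro a
    simp only [φ, isZeroCode]
    cases h : a.testBit 1
    · cases a.testBit 0 <;> simp [s0, s1]
    · simp only [s1, one_mul, Bool.not_true, Bool.and_false, Bool.false_eq_true, iff_false]
      intro h0
      refine hω ⟨boolToF2 (a.testBit 0), ?_⟩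
      change s _ = ω
      linear_combination h0 - ω * h2
  refine ⟨φ, ⟨hxor, fun a b => ?_, ?_, hzero, ?_⟩,
    by simp [φ, s0, s1, Nat.testBit]⟩
  · have c1 : ∀ t, φ (bif t then 1 else 0) = s t := by
      intro t; cases t <;> simp [φ, s0, s1, Nat.testBit]
    have c2 : ∀ t, φ (bif t then 2 else 0) = s t * ω := by
      intro t; cases t <;> simp [φ, s0, s1, Nat.testBit]
    rw [mulCode, hxor, c1, c2]
    simp only [φ, sx, sm]
    linear_combination -s (a.testBit 1) * s (b.testBit 1) * hsq
  · simp [φ, s0, s1, Nat.testBit]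
  · have : Finite L := Nat.finite_of_card_ne_zero (by omega)
    have hinj : Function.Injective fun n : Fin 4 => φ n := by
      intro m n h
      have h' : φ ((m : ℕ) ^^^ n) = 0 := by
        rw [hxor, show φ m = φ n from h]; linear_combination φ n * h2
      have h'' : ∀ m n : Fin 4, isZeroCode ((m : ℕ) ^^^ n) → m = n := by decide
      exact h'' m n ((hzero _).1 h')
    have hbij := (Nat.bijective_iff_injective_and_card (fun n : Fin 4 => φ n)).2 ⟨hinj, by simp [hL]⟩
    intro x
    obtain ⟨n, rfl⟩ := hbij.surjective x
    exact ⟨n, n.2, rfl⟩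

lemma frob_apply (x : L) : frob (ZMod 2) x = x * x := by
  rw [FiniteField.coe_frobeniusAlgHom, ZMod.card]
  exact sq x

variable {φ : ℕ → L} (hφ : IsDecoding φ)

include hφ

namespace IsDecoding

lemma frob_eq (a : ℕ) : frob (ZMod 2) (φ a) = φ (mulCode a a) := by
  rw [frob_apply, hφ.map_mul]

lemma eq_iff (a b : ℕ) : φ a = φ b ↔ isZeroCode (a ^^^ b) := by
  have : CharP L 2 := charP_of_injective_algebraMap (algebraMap (ZMod 2) L).injective 2
  rw [← hφ.eq_zero_iff, hφ.map_xor, CharTwo.add_eq_zero]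

end IsDecoding

omit hφ in
lemma getD_mulVecCode (M : List (List ℕ)) (v : List ℕ) (i : Fin 6) :
    (mulVecCode M v).getD i 0 = dotCode (M.getD i []) v := by
  fin_cases i <;> rfl

lemma groupMatrix_eq (a b c d : ℕ) :
    groupMatrix (ZMod 2) (φ 2) (φ a) (φ b) (φ c) (φ d) =
      Matrix.of fun i j : Fin 6 => φ (((groupMatrixCode a b c d).getD i []).getD j 0) := by
  have h22 : mulCode 2 2 = 3 := rfl
  have h1 : φ 3 * φ 2 = 1 := hφ.three_mul_two
  ext i j
  fin_cases i <;> fin_cases j <;>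
    simp [groupMatrix, groupMatrixCode, hφ.map_zero, hφ.map_one, hφ.map_mul, hφ.map_xor,
      div_eq_mul_inv, hφ.inv_two, sq, ← hφ.map_mul 2 2, h22, hφ.inv_three, h1]

lemma groupMatrix_mulVec (a b c d : ℕ) (v : List ℕ) :
    (groupMatrix (ZMod 2) (φ 2) (φ a) (φ b) (φ c) (φ d)).mulVec (fun i : Fin 6 => φ (v.getD i 0)) =
      fun i : Fin 6 => φ ((mulVecCode (groupMatrixCode a b c d) v).getD i 0) := by
  rw [groupMatrix_eq hφ]
  ext i
  rw [getD_mulVecCode, hφ.map_dotCode]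
  rfl

lemma groupMatrix_mul {t : ℕ × ℕ × ℕ × ℕ} (ht : t ∈ quadruples) :
    groupMatrix (ZMod 2) (φ 2) (φ t.1) (φ t.2.1) (φ t.2.2.1) (φ t.2.2.2) *
      groupMatrix (ZMod 2) (φ 2) (φ t.2.2.2) (φ t.2.1) (φ t.2.2.1) (φ t.1) = 1 := by
  ext i j
  have h := congrArg φ (groupMatrixCode_mul t ht i i.2 j j.2)
  rw [hφ.map_dotCode] at h
  have hcol : ∀ (M : List (List ℕ)) (k : ℕ), (columnCode M j).getD k 0 = (M.getD k []).getD j 0 := by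
    intro M k
    simp only [columnCode, List.getD_eq_getElem?_getD, List.getElem?_map]
    cases M[k]? <;> simp
  simp only [hcol] at h
  rw [groupMatrix_eq hφ, groupMatrix_eq hφ, Matrix.mul_apply, Matrix.one_apply]
  simp only [Matrix.of_apply]
  rw [h]
  simp only [Fin.val_inj]
  split_ifs
  exacts [hφ.map_one, hφ.map_zero]

lemma mem_quadruples {a b c d : ℕ} (ha : a < 4) (hb : b < 4) (hc : c < 4) (hd : d < 4)
    (h : φ a * φ d + φ b * φ c = 1) : (a, b, c, d) ∈ quadruples := by
  rw [← hφ.map_mul, ← hφ.map_mul, ← hφ.map_xor, ← hφ.map_one, hφ.eq_iff] at h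
  -- Decoding ignores all bits but the lowest two, so equality of decoded values must be turned into
  -- equality of codes by a check on codes below 4.
  have key : ∀ a < 4, ∀ b < 4, ∀ c < 4, ∀ d < 4,
      isZeroCode (mulCode a d ^^^ mulCode b c ^^^ 1) → mulCode a d ^^^ mulCode b c = 1 := by
    decide +kernel
  simp [quadruples, ha, hb, hc, hd, key a ha b hb c hc d hd h]

omit hφ in
lemma det_of_mem_quadruples : ∀ t ∈ quadruples,
    mulCode t.1 t.2.2.2 ^^^ mulCode t.2.1 t.2.2.1 = 1 := by
  decide +kernel

/-- The elements of the group permute the vectors of the orbit. -/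
lemma mulVec_mem_of_mem_groupG {g : GL (Fin 6) L} (hg : g ∈ groupG (ZMod 2) (φ 2)) :
    ∀ v ∈ orbitCode,
      (∃ w ∈ orbitCode, (g : Matrix (Fin 6) (Fin 6) L).mulVec (fun i : Fin 6 => φ (v.getD i 0)) =
        fun i : Fin 6 => φ (w.getD i 0)) ∧
      ∃ w ∈ orbitCode, ((g⁻¹ : GL (Fin 6) L) : Matrix (Fin 6) (Fin 6) L).mulVec
        (fun i : Fin 6 => φ (v.getD i 0)) = fun i : Fin 6 => φ (w.getD i 0) := by
  -- The claims for `g` and for its inverse are carried together, which makes the case of inverses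
  -- immediate.
  induction hg using Subgroup.closure_induction with
  | mem g hg =>
    obtain ⟨a, b, c, d, hdet, hg⟩ := hg
    obtain ⟨a, ha, rfl⟩ := hφ.surjective a
    obtain ⟨b, hb, rfl⟩ := hφ.surjective b
    obtain ⟨c, hc, rfl⟩ := hφ.surjective c
    obtain ⟨d, hd, rfl⟩ := hφ.surjective d
    have ht := mem_quadruples hφ ha hb hc hd hdet
    have hmul : groupMatrix (ZMod 2) (φ 2) (φ a) (φ b) (φ c) (φ d) *
        groupMatrix (ZMod 2) (φ 2) (φ d) (φ b) (φ c) (φ a) = 1 :=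
      groupMatrix_mul hφ (t := (a, b, c, d)) ht
    have hinv : ((g⁻¹ : GL (Fin 6) L) : Matrix (Fin 6) (Fin 6) L) =
        groupMatrix (ZMod 2) (φ 2) (φ d) (φ b) (φ c) (φ a) := by
      rw [Matrix.coe_units_inv]
      refine Matrix.inv_eq_right_inv ?_
      rw [hg]
      exact hmul
    intro v hv
    have h₁ : mulVecCode (groupMatrixCode a b c d) v ∈ orbitCode :=
      mulVecCode_mem_orbitCode (a, b, c, d) ht v hv
    have h₂ : mulVecCode (groupMatrixCode d b c a) v ∈ orbitCode :=
      mulVecCode_mem_orbitCode (d, b, c, a) (swap_mem_quadruples (a, b, c, d) ht) v hv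
    rw [hg, hinv, groupMatrix_mulVec hφ, groupMatrix_mulVec hφ]
    exact ⟨⟨_, h₁, rfl⟩, ⟨_, h₂, rfl⟩⟩
  | one => exact fun v hv => ⟨⟨v, hv, by simp⟩, ⟨v, hv, by simp⟩⟩
  | mul g h _ _ hg hh =>
    intro v hv
    constructor
    · obtain ⟨w, hw, h₁⟩ := (hh v hv).1
      obtain ⟨w', hw', h₂⟩ := (hg w hw).1
      exact ⟨w', hw', by rw [Units.val_mul, ← Matrix.mulVec_mulVec, h₁, h₂]⟩
    · obtain ⟨w, hw, h₁⟩ := (hg v hv).2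
      obtain ⟨w', hw', h₂⟩ := (hh w hw).2
      exact ⟨w', hw', by rw [mul_inv_rev, Units.val_mul, ← Matrix.mulVec_mulVec, h₁, h₂]⟩
  | inv g _ hg => exact fun v hv => ⟨(hg v hv).2, by rw [inv_inv]; exact (hg v hv).1⟩

lemma pointS_eq (g : ℕ) : pointS (ZMod 2) (φ 2) (φ g) =
    fun i : Fin 6 => φ ((pointCode g).getD i 0) := by
  have h22 : mulCode 2 2 = 3 := rfl
  ext i
  fin_cases i <;>
    simp [pointS, pointCode, hφ.map_one, hφ.map_mul,
      hφ.map_xor, div_eq_mul_inv, hφ.inv_two, sq, ← hφ.map_mul 2 2, h22, hφ.inv_three]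

lemma mem_orbitS_iff {g : ℕ} (hg : g ∈ [2, 3]) (P : ℙ (ZMod 2) (baerSubspace (ZMod 2) L)) :
    P ∈ orbitS (ZMod 2) (φ 2) (φ g) ↔
      ∃ v ∈ orbitCode, (P.rep : Fin 6 → L) = fun i : Fin 6 => φ (v.getD i 0) := by
  constructor
  · rintro ⟨h, hh, t, ht, hP⟩
    obtain ⟨v, hv, hv'⟩ := (mulVec_mem_of_mem_groupG hφ hh _ (pointCode_mem g hg)).1
    rw [pointS_eq hφ, hv'] at hP
    refine ⟨v, hv, ?_⟩
    -- All vectors of the orbit have last coordinate 1, while the last coordinate of a vector of the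
    -- Baer subgeometry lies in `𝔽₂`. Hence the scalar `t` lies in `𝔽₂` and equals 1.
    have h5 : ∀ v ∈ orbitCode, v.getD 5 0 = 1 := by decide
    obtain ⟨α, β, d₀, d₁, hd⟩ := P.rep.2
    have ht' : t = algebraMap (ZMod 2) L d₁ := by
      have h₁ := congrFun hP 5
      have h₂ := congrFun hd 5
      rw [h₁] at h₂
      simp only [Pi.smul_apply, smul_eq_mul] at h₂
      change t * φ (v.getD 5 0) = algebraMap (ZMod 2) L d₁ at h₂
      rwa [h5 v hv, hφ.map_one, mul_one] at h₂
    have h01 : ∀ d : ZMod 2, d = 0 ∨ d = 1 := by decide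
    rcases h01 d₁ with rfl | rfl
    · simp [ht'] at ht
    · simpa [ht'] using hP
  · rintro ⟨v, hv, hP⟩
    obtain ⟨t, ht, htv⟩ := orbitCode_transitive g hg v hv
    have h₁ := groupMatrix_mul hφ ht
    have h₂ := groupMatrix_mul hφ (swap_mem_quadruples t ht)
    have hdet := det_of_mem_quadruples t ht
    obtain ⟨a, b, c, d⟩ := t
    dsimp only at h₁ h₂ hdet htv
    let h : GL (Fin 6) L := ⟨_, _, h₁, h₂⟩
    refine ⟨h, Subgroup.subset_closure ⟨φ a, φ b, φ c, φ d, ?_, rfl⟩, 1, one_ne_zero, ?_⟩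
    · rw [← hφ.map_mul, ← hφ.map_mul, ← hφ.map_xor, hdet, hφ.map_one]
    · change _ = (1 : L) • (groupMatrix (ZMod 2) (φ 2) (φ a) (φ b) (φ c) (φ d)).mulVec _
      rw [one_smul, pointS_eq hφ, groupMatrix_mulVec hφ, htv, hP]

end FourElements

/-! ### The second construction in a symplectic basis of the Baer subgeometry -/

section Glued

variable {L : Type*} [Field L] [Algebra (ZMod 2) L] {φ : ℕ → L} (hφ : IsDecoding φ)

theorem baerBasisCode_mem : ∀ i < 6, ∃ a < 4, ∃ b < 4, ∃ d₀ < 2, ∃ d₁ < 2,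
    baerBasisCode.getD i [] = [a, mulCode a a, d₀, b, mulCode b b, d₁] := by
  decide +kernel

lemma mk_mem_vectors_iff {V : Type*} [AddCommGroup V] [Module (ZMod 2) V] {X : Set (ℙ (ZMod 2) V)}
    {v : V} (hv : v ≠ 0) : v ∈ vectors X ↔ Projectivization.mk (ZMod 2) v hv ∈ X := by
  rw [← rep_mem_vectors, rep_mk]

include hφ

lemma IsDecoding.eq_algebraMap {d : ℕ} (hd : d < 2) : φ d = algebraMap (ZMod 2) L d := by
  interval_cases d
  · simp [hφ.map_zero]
  · simp [hφ.map_one]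

lemma mem_baerSubspace {a b d₀ d₁ : ℕ} (h₀ : d₀ < 2) (h₁ : d₁ < 2) :
    (fun i : Fin 6 => φ ([a, mulCode a a, d₀, b, mulCode b b, d₁].getD i 0)) ∈
      baerSubspace (ZMod 2) L := by
  refine ⟨φ a, φ b, d₀, d₁, ?_⟩
  rw [← hφ.eq_algebraMap h₀, ← hφ.eq_algebraMap h₁, hφ.frob_eq, hφ.frob_eq]
  ext i
  fin_cases i <;> rfl

lemma baerBasis_mem (i : Fin 6) : (fun j : Fin 6 => φ ((baerBasisCode.getD i []).getD j 0)) ∈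
    baerSubspace (ZMod 2) L := by
  obtain ⟨a, -, b, -, d₀, h₀, d₁, h₁, h⟩ := baerBasisCode_mem i i.2
  rw [h]
  exact mem_baerSubspace hφ h₀ h₁

/-- The vectors with codes `baerBasisCode`. -/
def baerBasis (i : Fin 6) : baerSubspace (ZMod 2) L := ⟨_, baerBasis_mem hφ i⟩

lemma hermMatrix_eq (i j : Fin 6) :
    hermMatrix (ZMod 2) (φ 2) i j = φ ((hermCode.getD i []).getD j 0) := by
  have h3 : frob (ZMod 2) (φ 2) = φ 3 := hφ.frob_eq 2
  rw [hermMatrix, h3]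
  fin_cases i <;> fin_cases j <;> simp [hermCode, hφ.map_zero, hφ.map_one]

lemma isSymplectic_baerBasis :
    IsSymplectic (baerForm (ZMod 2) (φ 2)) (1 : L) (baerBasis hφ) := by
  intro i j
  have h := congrArg φ (baerBasisCode_form i i.2 j j.2)
  rw [hφ.map_dotCode] at h
  have hmap : ∀ (l : List ℕ) (k : ℕ), (l.map fun x => mulCode x x).getD k 0 =
      mulCode (l.getD k 0) (l.getD k 0) := by
    intro l k
    simp only [List.getD_eq_getElem?_getD, List.getElem?_map]
    cases l[k]? <;> simp [mulCode]
  simp only [getD_mulVecCode, hφ.map_dotCode, hmap, ← hφ.frob_eq, ← hermMatrix_eq hφ,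
    Finset.mul_sum, ← mul_assoc] at h
  refine Eq.trans ?_ (h.trans ?_)
  · rfl
  · split_ifs
    exacts [hφ.map_one, hφ.map_zero]

lemma coe_vec_baerBasis (n : ℕ) (j : Fin 6) :
    ((vec (baerBasis hφ) n : baerSubspace (ZMod 2) L) : Fin 6 → L) j = φ (baerCoordCode n j) := by
  have hs : ∀ (t : Bool) (x : ℕ), φ (bif t then x else 0) = boolToF2 t • φ x := by
    intro t x
    cases t <;> simp [boolToF2, hφ.map_zero]
  simp only [baerCoordCode, hφ.map_xor, hs, vec, Fin.sum_univ_six]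
  rfl

lemma exists_vec_baerBasis (x : baerSubspace (ZMod 2) L) : ∃ n, vec (baerBasis hφ) n = x := by
  obtain ⟨_, α, β, d₀, d₁, rfl⟩ := x
  obtain ⟨a, ha, rfl⟩ := hφ.surjective α
  obtain ⟨b, hb, rfl⟩ := hφ.surjective β
  obtain ⟨n, -, hn⟩ := exists_baerCoordCode a ha b hb d₀.val d₀.val_lt d₁.val d₁.val_lt
  refine ⟨n, Subtype.ext (funext fun j => ?_)⟩
  rw [coe_vec_baerBasis, hn j j.2]
  have hd : ∀ d : ZMod 2, φ d.val = algebraMap (ZMod 2) L d := fun d => by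
    rw [hφ.eq_algebraMap d.val_lt, ZMod.natCast_zmod_val]
  fin_cases j
  exacts [rfl, (hφ.frob_eq a).symm, hd d₀, rfl, (hφ.frob_eq b).symm, hd d₁]

/-- Independence comes from the Gram matrix, and spanning from the finite check that every vector of
the Baer subgeometry has a code. -/
lemma exists_basis_eq_baerBasis :
    ∃ b : Basis (Fin 6) (ZMod 2) (baerSubspace (ZMod 2) L), ⇑b = baerBasis hφ := by
  refine ⟨Basis.mk ((isSymplectic_baerBasis hφ).linearIndependent one_ne_zero) fun x _ => ?_,
    Basis.coe_mk _ _⟩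
  obtain ⟨n, rfl⟩ := exists_vec_baerBasis hφ x
  exact Submodule.sum_mem _ fun i _ => Submodule.smul_mem _ _ (Submodule.subset_span ⟨i, rfl⟩)

/-- The resulting code involves neither `ω` nor `γ`, which is why the isomorphism class does not
depend on them. -/
theorem gluedSet_eq {b : Basis (Fin 6) (ZMod 2) (baerSubspace (ZMod 2) L)}
    (hb : ⇑b = baerBasis hφ) {g : ℕ} (hg : g ∈ [2, 3]) :
    gluedSet (ZMod 2) (φ 2) (φ g) = pointSet b gluedCode := by
  refine eq_pointSet fun n hn h0 => ?_
  have hv : ∀ j : Fin 6, ((vec b n : baerSubspace (ZMod 2) L) : Fin 6 → L) j =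
      φ (baerCoordCode n j) := fun j => by
    rw [hb, coe_vec_baerBasis]
  rw [mk_mem_vectors_iff (vec_ne_zero b hn h0), isGluedCode_eq n hn h0, isGluedCode, gluedSet,
    Set.mem_union, mem_orbitS_iff hφ hg, Bool.or_eq_true, rep_mk]
  refine or_congr ?_ ?_
  · change (_ = 0 ∧ _ = 0) ↔ _
    simp only [rep_mk, hv, sq, ← hφ.map_mul, ← hφ.map_xor, hφ.eq_zero_iff, Bool.and_eq_true]
    rfl
  · simp only [List.any_eq_true, List.all_eq_true, List.mem_range, ← hφ.eq_iff]
    refine exists_congr fun v => and_congr_right fun _ => ?_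
    rw [funext_iff]
    simp only [hv]
    exact ⟨fun h j hj => h ⟨j, hj⟩, fun h j => h j j.2⟩

end Glued

/-! ### Complements and the possible values of `m` -/

section Complement

variable {V : Type*} [AddCommGroup V] [Module (ZMod 2) V] {B : V →ₗ[ZMod 2] V →ₗ[ZMod 2] ZMod 2}
  (hB : B.IsAlt) (hB' : LinearMap.Nondegenerate B) {b : Basis (Fin 6) (ZMod 2) V}
  (hb : IsSymplectic B 1 b)

include hB hB' hb

lemma encard_generator {g : Submodule (ZMod 2) V} (hg : IsGenerator B g) :
    {P : ℙ (ZMod 2) V | P.submodule ≤ g}.encard = 7 := by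
  classical
  rw [isGenerator_iff hB hB' hb] at hg
  obtain ⟨x, y, z, h, rfl, -⟩ := exists_planeSpan_eq hb hg.1 hg.2
  have h7 := encard_inter_planeSpan b h Set.univ
  simp only [Set.mem_univ, true_and] at h7
  rw [h7, List.countP_eq_length.2]
  · rfl
  · intro n hn
    have hp := isPlane_iff.1 h
    have hn' := lt_of_mem_planePoints hp.1.1 hp.1.2.1 hp.1.2.2 (List.mem_cons_of_mem _ hn)
    have h0 : n ≠ 0 := by
      rintro rfl
      exact (List.nodup_cons.1 hp.2.1).1 hn
    rw [decide_eq_true_eq, mk_mem_vectors_iff (vec_ne_zero b hn' h0)]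
    trivial

lemma IsMOvoid.encard_compl_add {m : ℕ} {X : Set (ℙ (ZMod 2) V)} (hX : IsMOvoid B m X)
    {g : Submodule (ZMod 2) V} (hg : IsGenerator B g) :
    {P ∈ Xᶜ | P.submodule ≤ g}.encard + m = 7 := by
  rw [← hX g hg, ← encard_generator hB hB' hb hg, add_comm, ← Set.encard_union_eq]
  · congr 1
    ext P
    change (_ ∧ _) ∨ (_ ∧ _) ↔ _
    rw [← or_and_right]
    exact and_iff_right (em _)
  · exact Set.disjoint_left.2 fun P h h' => h'.1 h.1

lemma IsMOvoid.le_seven {m : ℕ} {X : Set (ℙ (ZMod 2) V)} (hX : IsMOvoid B m X) : m ≤ 7 := by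
  have h := hX.encard_compl_add hB hB' hb
    (isGenerator_planeSpan hB hB' hb (x := 1) (y := 2) (z := 4) (by decide))
  exact_mod_cast le_add_self.trans h.le

lemma IsMOvoid.compl {m : ℕ} {X : Set (ℙ (ZMod 2) V)} (hX : IsMOvoid B m X) :
    IsMOvoid B (7 - m) Xᶜ := by
  intro g hg
  have h := hX.encard_compl_add hB hB' hb hg
  have h7 := hX.le_seven hB hB' hb
  have h' : (7 : ℕ∞) = ((7 - m : ℕ) : ℕ∞) + m := by
    rw [← Nat.cast_add, Nat.sub_add_cancel h7]; rfl
  rw [h'] at h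
  exact (ENat.add_left_injective_of_ne_top (ENat.natCast_ne_top m)) h

omit hB hB' hb in
lemma isMOvoid_empty : IsMOvoid B 0 (∅ : Set (ℙ (ZMod 2) V)) := by
  intro g _
  simp

/-- The case trees exclude 1 and 2, and complements then exclude 6 and 5. The elliptic quadric, the
empty set and their complements realize the other values. -/
lemma isMOvoid_iff_exists (m : ℕ) : (∃ X : Set (ℙ (ZMod 2) V), IsMOvoid B m X) ↔
    m = 0 ∨ m = 3 ∨ m = 4 ∨ m = 7 := by
  have no1 : ∀ X, ¬ IsMOvoid B 1 X := fun X hX => by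
    simpa using exists_eq_pointSet_of_check hB hB' hX _ noOneOvoidTree_check hb
  have no2 : ∀ X, ¬ IsMOvoid B 2 X := fun X hX => by
    simpa using exists_eq_pointSet_of_check hB hB' hX _ noTwoOvoidTree_check hb
  have h3 := isMOvoid_pointSet hB hB' hb isThreeOvoidCode_ellipticCode
  constructor
  · rintro ⟨X, hX⟩
    have h7 := hX.le_seven hB hB' hb
    have hc := hX.compl hB hB' hb
    interval_cases m
    · simp
    · exact (no1 _ hX).elim
    · exact (no2 _ hX).elim
    · simp
    · simp
    · exact (no2 _ hc).elim
    · exact (no1 _ hc).elim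
    · simp
  · rintro (rfl | rfl | rfl | rfl)
    exacts [⟨_, isMOvoid_empty⟩, ⟨_, h3⟩, ⟨_, h3.compl hB hB' hb⟩,
      ⟨_, isMOvoid_empty.compl hB hB' hb⟩]

end Complement

end SymplecticOvoid

open SymplecticOvoid Polynomial in
theorem mainTheorem3 {V : Type*} [AddCommGroup V] [Module (ZMod 2) V]
    (hV : Module.finrank (ZMod 2) V = 6)
    (B : V →ₗ[ZMod 2] V →ₗ[ZMod 2] ZMod 2) (hB : B.IsAlt) (hB' : LinearMap.Nondegenerate B) :
    (∀ m : ℕ, (∃ X : Set (ℙ (ZMod 2) V), IsMOvoid B m X) ↔ m = 0 ∨ m = 3 ∨ m = 4 ∨ m = 7) ∧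
    ∃ X₁ X₂ X₃ : Set (ℙ (ZMod 2) V),
      -- three pairwise non-isomorphic `3`-ovoids, and every `3`-ovoid is isomorphic to one of them
      (IsMOvoid B 3 X₁ ∧ IsMOvoid B 3 X₂ ∧ IsMOvoid B 3 X₃) ∧
      (¬ Isomorphic B X₁ B X₂ ∧ ¬ Isomorphic B X₁ B X₃ ∧ ¬ Isomorphic B X₂ B X₃) ∧
      (∀ X, IsMOvoid B 3 X →
        Isomorphic B X B X₁ ∨ Isomorphic B X B X₂ ∨ Isomorphic B X B X₃) ∧
      -- the first one is the elliptic quadric polarizing to the polar space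
      (IsEllipticQuadricPolarizingTo B X₁ ∧
        ∀ X, IsEllipticQuadricPolarizingTo B X → Isomorphic B X B X₁) ∧
      -- the second one is the example of the first construction
      (∀ δ μ : ZMod 2, Irreducible (X ^ 2 + X + C δ : (ZMod 2)[X]) → μ ≠ 0 →
        Isomorphic B X₂ (antidiagForm (ZMod 2)) (pencilQuadric δ μ)) ∧
      -- the third one is the example of the second construction
      (∀ ω γ : GaloisField 2 2, ω ∉ Set.range (algebraMap (ZMod 2) (GaloisField 2 2)) →
        ω + ω ^ 2 = 1 → Irreducible (X ^ 2 + X + C γ : (GaloisField 2 2)[X]) →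
        Isomorphic B X₃ (baerForm (ZMod 2) ω) (gluedSet (ZMod 2) ω γ)) := by
  obtain ⟨b, hb⟩ := exists_isSymplectic hV B hB hB'
  have h1 : (1 : ZMod 2) ≠ 0 := one_ne_zero
  have hline := fun {R : ℕ} hR => isLineClosed_pointSet_iff hb (R := R) hR
  have hcov := fun {R : ℕ} hR => isCoveredByLines_pointSet_iff hb (R := R) hR
  have z₁ : ellipticCode.testBit 0 = false := by decide +kernel
  have z₂ : pencilCode.testBit 0 = false := by decide +kernel
  have z₃ : gluedCode.testBit 0 = false := by decide +kernel
  refine ⟨isMOvoid_iff_exists hB hB' hb, pointSet b ellipticCode, pointSet b pencilCode,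
    pointSet b gluedCode, ⟨isMOvoid_pointSet hB hB' hb isThreeOvoidCode_ellipticCode,
      isMOvoid_pointSet hB hB' hb isThreeOvoidCode_pencilCode,
      isMOvoid_pointSet hB hB' hb isThreeOvoidCode_gluedCode⟩,
    ⟨fun h => ?_, fun h => ?_, fun h => ?_⟩, fun X hX => ?_,
    ⟨isEllipticQuadricPolarizingTo_pointSet hB hB' hb, fun X hX => ?_⟩,
    fun δ μ hδ hμ => ?_, fun ω γ hω hω' hγ => ?_⟩
  · have := ((hline z₁).2 isLineClosedCode_ellipticCode).of_isomorphic h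
    rw [hline z₂, isLineClosedCode_pencilCode] at this
    exact Bool.false_ne_true this
  · have := ((hline z₁).2 isLineClosedCode_ellipticCode).of_isomorphic h
    rw [hline z₃, isLineClosedCode_gluedCode] at this
    exact Bool.false_ne_true this
  · have := ((hcov z₂).2 isCoveredByLinesCode_pencilCode).of_isomorphic h
    rw [hcov z₃, isCoveredByLinesCode_gluedCode] at this
    exact Bool.false_ne_true this
  · obtain ⟨R, hR, b', hb', rfl⟩ :=
      exists_eq_pointSet_of_check hB hB' hX _ threeOvoidTree_check hb
    simp only [List.mem_cons, List.not_mem_nil, or_false] at hR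
    rcases hR with rfl | rfl | rfl
    exacts [.inl (isomorphic_pointSet h1 h1 hb' hb _),
      .inr (.inl (isomorphic_pointSet h1 h1 hb' hb _)),
      .inr (.inr (isomorphic_pointSet h1 h1 hb' hb _))]
  · obtain ⟨b', hb', rfl⟩ := exists_eq_pointSet_ellipticCode hb hX
    exact isomorphic_pointSet h1 h1 hb' hb _
  · have h01 : ∀ t : ZMod 2, t ≠ 0 → t = 1 := by decide
    obtain rfl := h01 μ hμ
    -- For `δ = 0` the polynomial has the root 0.
    obtain rfl := h01 δ fun h => ne_zero_of_irreducible hδ 0 (by simp [h])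
    rw [pencilQuadric_eq]
    exact isomorphic_pointSet h1 h1 hb isSymplectic_antidiagForm _
  · obtain ⟨φ, hφ, rfl⟩ := exists_isDecoding (GaloisField.card 2 2 two_ne_zero) hω hω'
    obtain ⟨g, hg, rfl⟩ := hφ.surjective γ
    -- Irreducibility excludes `γ = 0`, where 0 is a root, and `γ = 1`, where `ω` is a root; so `γ`
    -- is `ω` or `ω + 1`.
    have hg' : g ∈ [2, 3] := by
      interval_cases g
      · exact (ne_zero_of_irreducible hγ 0 (by simp [hφ.map_zero])).elim
      · refine (ne_zero_of_irreducible hγ (φ 2) ?_).elim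
        rw [sq, ← hφ.map_mul, ← hφ.map_xor, ← hφ.map_xor, hφ.eq_zero_iff]
        decide
      · simp
      · simp
    obtain ⟨b', hb'⟩ := exists_basis_eq_baerBasis hφ
    rw [gluedSet_eq hφ hb' hg']
    exact isomorphic_pointSet h1 one_ne_zero hb (hb' ▸ isSymplectic_baerBasis hφ) _
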